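/- **Setting.** Let $G,H\in\mathbb R^{2\times 2}$ be the payoffs $G(i,j)$, $H(i,j)$ ($i,j\in\{0,1\}$) of players $1$ and $2$ in a competitive game, that is, either $G(0,0)>G(1,0)$, $G(0,1)<G(1,1)$, $H(0,0)<H(0,1)$, $H(1,0)>H(1,1)$, or all four inequalities are reversed. Let $(p^*,q^*)$ be its (unique, completely mixed) Nash equilibrium, where $p^*,q^*$ are the probabilities of action $1$. The game is repeated with mean-based strategies given by arbitrary functions $f_t,g_t:[0,1]\to[0,1]$, $t\ge 1$ (no monotonicity is assumed): in round $t$, given the past, the actions $I_t,J_t\in\{0,1\}$ are drawn independently with $\Pr(I_t=1)=P_t:=f_t(\widehat Q_{t-1})$ and $\Pr(J_t=1)=Q_t:=g_t(\widehat P_{t-1})$, where $\widehat P_t=\frac1t\sum_{s\le t}I_s$, $\widehat Q_t=\frac1t\sum_{s\le t}J_s$ (and $\widehat P_0=\widehat Q_0=0$). *Regret rate.* The strategy $\{f_t\}$ of player $1$ has regret rate $(1/2,c)$ if $$\limsup_{T\to\infty}\ \max_{j_1,\dots,j_T\in\{0,1\}}\ \frac1{\sqrt T}\Big[\max_{i\in\{0,1\}}\sum_{t=1}^T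 G(i,j_t)-\sum_{t=1}^T\big((1-x_t)G(0,j_t)+x_tG(1,j_t)\big)\Big]\le c,\qquad x_t=f_t\Big(\tfrac1{t-1}\sum_{s<t}j_s\Big)$$ (the argument of $f_1$ being $0$); the regret rate of player $2$'s strategy $\{g_t\}$ is defined in the same way, with the roles of the players exchanged and the payoff $H$. *Shaky hands.* Let $Z'_t$ be a sum of independent Bernoulli variables with success probabilities $\mathbb E[Q_1],\dots,\mathbb E[Q_t]$. The strategies have the shaky-hands property if for every $\gamma>0$ there are $\epsilon>0$ and $T>0$ such that $$\Pr(t\widehat Q_t=z)\ \ge\ \epsilon\,\Pr(Z'_t=z)\qquad\text{for all } t\ge T \text{ and all integers } z\in[tq^*-\gamma\sqrt t,\;tq^*+\gamma\sqrt t].$$ **Theorem.** Suppose that the mean-based strategies $\{f_t\}$, $\{g_t\}$ have the shaky-hands property, that $\{f_t\}$ has regret rate $(1/2,c_1)$ and that $\{g_t\}$ has regret rate $(1/2,c_2)$, for some real constants $c_1,c_2$. Then player $1$'s last iterate does not converge to $p^*$ in probability: there are constants $\delta>0$ and $\epsilon_0>0$ such that $$\limsup_{t\to\infty}\ \Pr\big(|P_t-p^*|\ge\delta\big)\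 \ge\ \epsilon_0 .$$ -/

import Mathlib

open MeasureTheory ProbabilityTheory Filter

namespace RepeatedGame

noncomputable section

/-- Payoff table of a `2 × 2` game for one of the players; the actions are `0` and `1`. -/
abbrev Payoff := Fin 2 → Fin 2 → ℝ

/-- A `2 × 2` game with payoffs `G i j` (player 1) and `H i j` (player 2) is competitive. -/
def IsCompetitive (G H : Payoff) : Prop :=
  (G 1 0 < G 0 0 ∧ G 0 1 < G 1 1 ∧ H 0 0 < H 0 1 ∧ H 1 1 < H 1 0) ∨
  (G 0 0 < G 1 0 ∧ G 1 1 < G 0 1 ∧ H 0 1 < H 0 0 ∧ H 1 0 < H 1 1)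

/-- Expected payoff when the two players independently play action `1` with probabilities
`p` and `q`. -/
def mixedPayoff (X : Payoff) (p q : ℝ) : ℝ :=
  (1 - p) * (1 - q) * X 0 0 + (1 - p) * q * X 0 1 + p * (1 - q) * X 1 0 + p * q * X 1 1

/-- `(p, q)` is a (mixed) Nash equilibrium of the game `(G, H)`. -/
def IsNashEquilibrium (G H : Payoff) (p q : unitInterval) : Prop :=
  (∀ p' : unitInterval, mixedPayoff G p' q ≤ mixedPayoff G p q) ∧
  (∀ q' : unitInterval, mixedPayoff H p q' ≤ mixedPayoff H p q)

lemma avg_mem (x : ℕ → Fin 2) (t : ℕ) :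
    (∑ s ∈ Finset.Icc 1 t, ((x s : ℕ) : ℝ)) / t ∈ unitInterval := by
  have h0 : (0 : ℝ) ≤ ∑ s ∈ Finset.Icc 1 t, ((x s : ℕ) : ℝ) :=
    Finset.sum_nonneg fun s _ => Nat.cast_nonneg _
  have h1 : ∑ s ∈ Finset.Icc 1 t, ((x s : ℕ) : ℝ) ≤ t := by
    have : ∑ s ∈ Finset.Icc 1 t, ((x s : ℕ) : ℝ) ≤ ∑ _s ∈ Finset.Icc 1 t, (1 : ℝ) :=
      Finset.sum_le_sum fun s _ => by
        have : (x s : ℕ) ≤ 1 := by omega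
        exact_mod_cast this
    simpa using this
  exact ⟨by positivity, div_le_one_of_le₀ h1 (by positivity)⟩

/-- Empirical average `(x 1 + ⋯ + x t) / t` of an action sequence indexed by the rounds
`1, 2, …` (the entry `x 0` is never used). The average of no rounds is `0`. -/
def empAvg (x : ℕ → Fin 2) (t : ℕ) : unitInterval :=
  ⟨(∑ s ∈ Finset.Icc 1 t, ((x s : ℕ) : ℝ)) / t, avg_mem x t⟩

/-- The strategy functions of a mean-based strategy, one for each round `t = 1, 2, …`. -/
abbrev MeanBasedStrategy := ℕ → unitInterval → unitInterval

/-- The self-agnostic strategy of a mean-based strategy: the probability of playing action `1`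
in round `t` when the opponent has played `x 1, …, x (t - 1)`. -/
def response (f : MeanBasedStrategy) (t : ℕ) (x : ℕ → Fin 2) : unitInterval :=
  f t (empAvg x (t - 1))

/-- Regret after `T` rounds of a player with payoff `A (own action) (opponent's action)` who plays
action `1` in round `t` with probability `σ t x`, against the opponent's sequence `x`. -/
def regret (A : Payoff) (σ : ℕ → (ℕ → Fin 2) → unitInterval) (x : ℕ → Fin 2) (T : ℕ) : ℝ :=
  max (∑ t ∈ Finset.Icc 1 T, A 0 (x t)) (∑ t ∈ Finset.Icc 1 T, A 1 (x t)) -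
    ∑ t ∈ Finset.Icc 1 T, ((1 - (σ t x : ℝ)) * A 0 (x t) + (σ t x : ℝ) * A 1 (x t))

/-- The strategy has the uniform no-regret rate `(r, c)`:
`limsup_T max_x T ^ (-r) * regret_T(x) ≤ c`, the limsup being taken in the extended reals. -/
def HasRegretRate (A : Payoff) (σ : ℕ → (ℕ → Fin 2) → unitInterval) (r c : ℝ) : Prop :=
  limsup (fun T : ℕ => ⨆ x : ℕ → Fin 2, ((regret A σ x T / (T : ℝ) ^ r : ℝ) : EReal)) atTop
    ≤ (c : EReal)

/-- Probability of the action `a` under the mixed strategy that plays `1` with probability `p`. -/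
def actionProb (p : unitInterval) (a : Fin 2) : ℝ := if a = 1 then (p : ℝ) else 1 - p

variable {Ω : Type*} [MeasurableSpace Ω]

/-- The event that the actions in the rounds `1, …, t` are those of `i` and `j`. -/
def historyEvent (I J : ℕ → Ω → Fin 2) (t : ℕ) (i j : ℕ → Fin 2) : Set Ω :=
  {ω | ∀ s ∈ Finset.Icc 1 t, I s ω = i s ∧ J s ω = j s}

/-- `I`, `J` are the random action sequences of the game repeatedly played with the mean-based
strategies `f` and `g`: given the history of the rounds before `t`, the actions of round `t` are
drawn independently of each other from the players' current mixed strategies. -/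
structure IsPlay (μ : Measure Ω) (f g : MeanBasedStrategy) (I J : ℕ → Ω → Fin 2) : Prop where
  measurable_fst : ∀ t, Measurable (I t)
  measurable_snd : ∀ t, Measurable (J t)
  history : ∀ t, 1 ≤ t → ∀ i j : ℕ → Fin 2,
    μ.real (historyEvent I J t i j) = μ.real (historyEvent I J (t - 1) i j) *
      (actionProb (response f t j) (i t) * actionProb (response g t i) (j t))

/-- The random mixed strategy of a player in round `t`, when `X` is the opponent's random action
sequence. -/
def mixedStrategy (f : MeanBasedStrategy) (X : ℕ → Ω → Fin 2) (t : ℕ) (ω : Ω) : unitInterval :=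
  response f t (fun s => X s ω)

lemma integral_mem (μ : Measure Ω) [IsProbabilityMeasure μ] (Y : Ω → unitInterval) :
    ∫ ω, (Y ω : ℝ) ∂μ ∈ unitInterval := by
  refine ⟨integral_nonneg fun ω => (Y ω).2.1, ?_⟩
  have h := norm_integral_le_of_norm_le_const (μ := μ) (f := fun ω => (Y ω : ℝ)) (C := 1)
    (Eventually.of_forall fun ω => by
      rw [Real.norm_of_nonneg (Y ω).2.1]; exact (Y ω).2.2)
  simpa using (le_abs_self _).trans h

/-- Expectation of a `[0, 1]`-valued random variable. -/
def expect (μ : Measure Ω) [IsProbabilityMeasure μ] (Y : Ω → unitInterval) : unitInterval :=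
  ⟨∫ ω, (Y ω : ℝ) ∂μ, integral_mem μ Y⟩

/-- The law of the sum of independent Bernoulli variables with success probabilities
`r 1, …, r t`. -/
def bernoulliSumLaw (r : ℕ → unitInterval) (t : ℕ) : Measure ℕ :=
  (Measure.pi fun s : Finset.Icc 1 t => bernoulliMeasure (1 : ℕ) 0 (r s)).map fun x => ∑ s, x s

/-- Shaky hands: for every `γ > 0` there are `ε > 0` and `T` such that for all `t ≥ T` and all
integers `z` in `[t q - γ √t, t q + γ √t]`, the probability that player 2 has played action `1`
exactly `z` times in the first `t` rounds is at least `ε` times the probability that a sum of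
independent `Ber(𝔼[Q 1]), …, Ber(𝔼[Q t])` variables equals `z`. -/
def ShakyHands (μ : Measure Ω) [IsProbabilityMeasure μ] (g : MeanBasedStrategy)
    (I J : ℕ → Ω → Fin 2) (q : unitInterval) : Prop :=
  ∀ γ : ℝ, 0 < γ → ∃ ε : ℝ, 0 < ε ∧ ∃ T : ℕ, 0 < T ∧ ∀ t : ℕ, T ≤ t → ∀ z : ℕ,
    (z : ℝ) ∈ Set.Icc (t * (q : ℝ) - γ * √t) (t * (q : ℝ) + γ * √t) →
      ε * (bernoulliSumLaw (fun s => expect μ (mixedStrategy g I s)) t).real {z} ≤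
        μ.real {ω | (t : ℝ) * (empAvg (fun s => J s ω) t : ℝ) = z}

end

end RepeatedGame

open RepeatedGame

/-! Suppose player 1's mixed strategies do converge to `p` in probability, hence in mean. After
rescaling, the payoff differences are `e (j - q)` for player 1 and `-e (i - p)` for player 2, with
`e = ±1`. So the two regrets can be added as in a zero-sum game, and the sum is at most of order
`√T` on every path (`regret_sum_bound`).

Averaging this sum over the play bounds the mean of player 2's excess over `T q` by a multiple of
`√T` (`abs_sum_mean_sub_le`). Averaging it instead over a play in which player 1's actions are
tilted by `l (Q - q)`, with `l` of order `1 / √T`, produces the gain `l ∑ P (1 - P) (Q - q) ^ 2`. If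
player 2's mean strategies were mostly near `0` or `1`, then, as `P` is near `p`, this gain would
exceed the regret bounds. The tilted law has a likelihood ratio bounded in `L²`, so smallness in
mean carries over to it. Hence the variances `r (1 - r)` of the means `r = 𝔼[Q]` sum to at least `κ
T` (`exists_variance_lower_bound`).

Consequently the Bernoulli sum with these parameters has mass of order at least `1 / √t` at every
integer within `O(√t)` of `t q` (`exists_local_lower_bound`), and shaky hands passes this on to
player 2's actual counts. Convergence in mean then forces `f (t + 1)` to be close to `p`, on
average, over every window of `O(√t)` counts around `t q`.

Such flatness contradicts the regret bound of `f` alone (`not_flat_of_regret_bound`): an opponent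
playing action `1` independently with probability `q + e γ / √T`, after a uniformly random number of
initial ones, keeps the counts spread over these windows. The strategy plays about `p` throughout
and loses about `γ (1 - p) √T` to the better pure action, with `γ` arbitrarily large. -/

namespace RepeatedGame

noncomputable section

/-! ### Finite-horizon expectations along a transition kernel -/

/-- A transition kernel for a process with values in a finite type: `k t x a` is the probability
that round `t` produces `a` when the rounds `1, …, t - 1` have produced `x 1, …, x (t - 1)`. -/
structure IsTransition {α : Type*} [Fintype α] (k : ℕ → (ℕ → α) → α → ℝ) : Prop where
  nonneg : ∀ t x a, 0 ≤ k t x a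
  sum_eq_one : ∀ t x, ∑ a, k t x a = 1
  past : ∀ t a, DependsOn (fun x => k (t + 1) x a) (Set.Icc 1 t)

/-- Average a function of the path over the outcome of round `t`. -/
def stepExp {α : Type*} [Fintype α] (k : ℕ → (ℕ → α) → α → ℝ) (t : ℕ) :
    ((ℕ → α) → ℝ) →ₗ[ℝ] ((ℕ → α) → ℝ) where
  toFun F x := ∑ a, k t x a * F (Function.update x t a)
  map_add' F F' := by
    ext x; simp [mul_add, Finset.sum_add_distrib]
  map_smul' c F := by
    ext x; simp only [Pi.smul_apply, smul_eq_mul, Finset.mul_sum, RingHom.id_apply]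
    exact Finset.sum_congr rfl fun a _ => by ring

/-- Average a function of the path over the outcomes of the rounds `n + 1, …, n + m`. -/
def pathExp {α : Type*} [Fintype α] (k : ℕ → (ℕ → α) → α → ℝ) (n : ℕ) :
    ℕ → ((ℕ → α) → ℝ) →ₗ[ℝ] ((ℕ → α) → ℝ)
  | 0 => LinearMap.id
  | m + 1 => pathExp k n m ∘ₗ stepExp k (n + m + 1)

section
variable {α : Type*} [Fintype α] {k : ℕ → (ℕ → α) → α → ℝ}

lemma stepExp_apply (t : ℕ) (F : (ℕ → α) → ℝ) (x : ℕ → α) :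
    stepExp k t F x = ∑ a, k t x a * F (Function.update x t a) := rfl

@[simp] lemma pathExp_zero (n : ℕ) (F : (ℕ → α) → ℝ) : pathExp k n 0 F = F := rfl

lemma pathExp_succ (n m : ℕ) (F : (ℕ → α) → ℝ) :
    pathExp k n (m + 1) F = pathExp k n m (stepExp k (n + m + 1) F) := rfl

lemma stepExp_mono (hk : IsTransition k) (t : ℕ) {F F' : (ℕ → α) → ℝ} (h : ∀ x, F x ≤ F' x)
    (x : ℕ → α) : stepExp k t F x ≤ stepExp k t F' x :=
  Finset.sum_le_sum fun a _ => mul_le_mul_of_nonneg_left (h _) (hk.nonneg t x a)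

lemma pathExp_mono (hk : IsTransition k) (n m : ℕ) {F F' : (ℕ → α) → ℝ} (h : ∀ x, F x ≤ F' x)
    (x : ℕ → α) : pathExp k n m F x ≤ pathExp k n m F' x := by
  induction m generalizing F F' with
  | zero => exact h x
  | succ m ih => exact ih (stepExp_mono hk _ h)

lemma stepExp_const (hk : IsTransition k) (t : ℕ) (c : ℝ) :
    stepExp k t (fun _ => c) = fun _ => c := by
  ext x; rw [stepExp_apply, ← Finset.sum_mul, hk.sum_eq_one, one_mul]

lemma pathExp_const (hk : IsTransition k) (n m : ℕ) (c : ℝ) :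
    pathExp k n m (fun _ => c) = fun _ => c := by
  induction m with
  | zero => rfl
  | succ m ih => rw [pathExp_succ, stepExp_const hk, ih]

lemma pathExp_nonneg (hk : IsTransition k) (n m : ℕ) {F : (ℕ → α) → ℝ} (h : ∀ x, 0 ≤ F x)
    (x : ℕ → α) : 0 ≤ pathExp k n m F x := by
  have := pathExp_mono hk n m h x
  rwa [pathExp_const hk] at this

lemma pathExp_sum {ι : Type*} (n m : ℕ) (s : Finset ι) (F : ι → (ℕ → α) → ℝ) (x : ℕ → α) :
    pathExp k n m (fun y => ∑ i ∈ s, F i y) x = ∑ i ∈ s, pathExp k n m (F i) x := by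
  have : (fun y => ∑ i ∈ s, F i y) = ∑ i ∈ s, F i := by ext y; simp
  rw [this, map_sum, Finset.sum_apply]

lemma pathExp_add (n m : ℕ) (F F' : (ℕ → α) → ℝ) (x : ℕ → α) :
    pathExp k n m (fun y => F y + F' y) x = pathExp k n m F x + pathExp k n m F' x := by
  have : (fun y => F y + F' y) = F + F' := rfl
  rw [this, map_add, Pi.add_apply]

lemma pathExp_sub (n m : ℕ) (F F' : (ℕ → α) → ℝ) (x : ℕ → α) :
    pathExp k n m (fun y => F y - F' y) x = pathExp k n m F x - pathExp k n m F' x := by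
  have : (fun y => F y - F' y) = F - F' := rfl
  rw [this, map_sub, Pi.sub_apply]

lemma pathExp_const_mul (n m : ℕ) (c : ℝ) (F : (ℕ → α) → ℝ) (x : ℕ → α) :
    pathExp k n m (fun y => c * F y) x = c * pathExp k n m F x := by
  have : (fun y => c * F y) = c • F := rfl
  rw [this, map_smul, Pi.smul_apply, smul_eq_mul]

lemma abs_pathExp_le (hk : IsTransition k) (n m : ℕ) (F : (ℕ → α) → ℝ) (x : ℕ → α) :
    |pathExp k n m F x| ≤ pathExp k n m (fun y => |F y|) x := by
  rw [abs_le]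
  constructor
  · have := pathExp_mono hk n m (F := fun y => (-1) * |F y|) (F' := F)
      (fun y => by linarith [neg_abs_le (F y)]) x
    rw [pathExp_const_mul] at this; linarith
  · exact pathExp_mono hk n m (fun y => le_abs_self (F y)) x

omit [Fintype α] in
lemma dependsOn_update {F : (ℕ → α) → ℝ} {s t : ℕ} (hF : DependsOn F (Set.Icc 1 s)) (hst : s < t)
    (x : ℕ → α) (a : α) : F (Function.update x t a) = F x :=
  hF fun i hi => Function.update_of_ne (by rintro rfl; exact absurd hi.2 (by omega)) _ _

lemma stepExp_mul_left (t s : ℕ) {F : (ℕ → α) → ℝ} (hF : DependsOn F (Set.Icc 1 s)) (hst : s < t)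
    (F' : (ℕ → α) → ℝ) : stepExp k t (fun x => F x * F' x) = fun x => F x * stepExp k t F' x := by
  ext x
  simp only [stepExp_apply, dependsOn_update hF hst, Finset.mul_sum]
  exact Finset.sum_congr rfl fun a _ => by ring

lemma stepExp_of_dependsOn (hk : IsTransition k) (t s : ℕ) {F : (ℕ → α) → ℝ}
    (hF : DependsOn F (Set.Icc 1 s)) (hst : s < t) : stepExp k t F = F := by
  ext x
  simp only [stepExp_apply, dependsOn_update hF hst, ← Finset.sum_mul, hk.sum_eq_one, one_mul]

/-- Rounds that the integrand does not see integrate out, because each kernel has total mass one. -/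
lemma pathExp_of_dependsOn (hk : IsTransition k) {n s m m' : ℕ} {F : (ℕ → α) → ℝ}
    (hF : DependsOn F (Set.Icc 1 s)) (hm : s ≤ n + m) (hmm' : m ≤ m') :
    pathExp k n m' F = pathExp k n m F := by
  induction m', hmm' using Nat.le_induction with
  | base => rfl
  | succ m' h ih => rw [pathExp_succ, stepExp_of_dependsOn hk _ s hF (by omega), ih]

/-- In expectation, a function of the outcome of a round may be replaced by its mean given the
past, also when it is multiplied by a function of the past. -/
lemma pathExp_mul_outcome (hk : IsTransition k) (n m t : ℕ) (hnt : n ≤ t) (htm : t < n + m)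
    {F : (ℕ → α) → ℝ} (hF : DependsOn F (Set.Icc 1 t)) (ψ : α → ℝ) (x : ℕ → α) :
    pathExp k n m (fun y => F y * ψ (y (t + 1))) x =
      pathExp k n m (fun y => F y * ∑ a, k (t + 1) y a * ψ a) x := by
  obtain ⟨m₀, rfl⟩ := Nat.exists_eq_add_of_le hnt
  have h1 : DependsOn (fun y : ℕ → α => F y * ψ (y (n + m₀ + 1))) (Set.Icc 1 (n + m₀ + 1)) := by
    intro y y' h
    simp only
    rw [hF fun i hi => h i ⟨hi.1, hi.2.trans (Nat.le_succ _)⟩, h (n + m₀ + 1) ⟨by omega, le_rfl⟩]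
  have h2 : DependsOn (fun y : ℕ → α => F y * ∑ a, k (n + m₀ + 1) y a * ψ a)
      (Set.Icc 1 (n + m₀)) := by
    intro y y' h
    simp only
    rw [hF h]
    congr 1
    exact Finset.sum_congr rfl fun a _ => by
      have := hk.past (n + m₀) a h
      simp only at this
      rw [this]
  rw [pathExp_of_dependsOn hk h1 (m := m₀ + 1) (by omega) (by omega),
    pathExp_of_dependsOn hk h2 (m := m₀) (by omega) (by omega), pathExp_succ,
    stepExp_mul_left _ _ hF (Nat.lt_succ_self _)]
  simp only [stepExp_apply, Function.update_self]

/-! ### Change of measure -/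

/-- The likelihood ratio of the first `m` rounds. -/
def likelihood (ℓ : ℕ → (ℕ → α) → α → ℝ) (m : ℕ) (x : ℕ → α) : ℝ :=
  ∏ t ∈ Finset.range m, ℓ (t + 1) x (x (t + 1))

omit [Fintype α] in
lemma likelihood_dependsOn {ℓ : ℕ → (ℕ → α) → α → ℝ}
    (hℓ : ∀ t a, DependsOn (fun x => ℓ (t + 1) x a) (Set.Icc 1 t)) (m : ℕ) :
    DependsOn (likelihood ℓ m) (Set.Icc 1 m) := by
  intro x y h
  refine Finset.prod_congr rfl fun t ht => ?_
  have ht := Finset.mem_range.1 ht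
  rw [h (t + 1) ⟨by omega, by omega⟩]
  exact hℓ t _ fun i hi => h i ⟨hi.1, hi.2.trans ht.le⟩

/-- Change of measure: tilting the kernel multiplies the integrand by the likelihood ratio. -/
lemma pathExp_tilt {ℓ : ℕ → (ℕ → α) → α → ℝ}
    (hℓ : ∀ t a, DependsOn (fun x => ℓ (t + 1) x a) (Set.Icc 1 t)) (m : ℕ)
    (F : (ℕ → α) → ℝ) (x : ℕ → α) :
    pathExp (fun t x a => k t x a * ℓ t x a) 0 m F x =
      pathExp k 0 m (fun y => likelihood ℓ m y * F y) x := by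
  induction m generalizing F with
  | zero => simp [likelihood]
  | succ m ih =>
    rw [pathExp_succ, ih, pathExp_succ]
    refine congrFun (congrArg _ (funext fun y => ?_)) x
    simp only [stepExp_apply, Finset.mul_sum, zero_add]
    refine Finset.sum_congr rfl fun a _ => ?_
    have h1 : likelihood ℓ (m + 1) (Function.update y (m + 1) a) =
        likelihood ℓ m y * ℓ (m + 1) y a := by
      rw [likelihood, Finset.prod_range_succ, ← likelihood,
        dependsOn_update (likelihood_dependsOn hℓ m) (Nat.lt_succ_self m), Function.update_self,
        dependsOn_update (hℓ m a) (Nat.lt_succ_self m)]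
    rw [h1]; ring

/-- Integrate the last round first: given the past, its factor contributes a second moment of at
most `b`. -/
lemma pathExp_likelihood_sq_le (hk : IsTransition k) {ℓ : ℕ → (ℕ → α) → α → ℝ}
    (hℓ : ∀ t a, DependsOn (fun x => ℓ (t + 1) x a) (Set.Icc 1 t)) {b : ℝ} (hb : 0 ≤ b)
    (hle : ∀ t x, ∑ a, k (t + 1) x a * ℓ (t + 1) x a ^ 2 ≤ b) (m : ℕ) (x : ℕ → α) :
    pathExp k 0 m (fun y => likelihood ℓ m y ^ 2) x ≤ b ^ m := by
  induction m with
  | zero => simp [likelihood]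
  | succ m ih =>
    have h1 : ∀ y, stepExp k (0 + m + 1) (fun y => likelihood ℓ (m + 1) y ^ 2) y ≤
        b * likelihood ℓ m y ^ 2 := by
      intro y
      rw [stepExp_apply]
      calc _ = ∑ a, likelihood ℓ m y ^ 2 * (k (m + 1) y a * ℓ (m + 1) y a ^ 2) := by
            refine Finset.sum_congr rfl fun a _ => ?_
            rw [zero_add, likelihood, Finset.prod_range_succ, ← likelihood,
              dependsOn_update (likelihood_dependsOn hℓ m) (Nat.lt_succ_self m),
              Function.update_self, dependsOn_update (hℓ m a) (Nat.lt_succ_self m)]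
            ring
        _ ≤ _ := by
            rw [← Finset.mul_sum, mul_comm]
            exact mul_le_mul_of_nonneg_right (hle m y) (sq_nonneg _)
    rw [pathExp_succ]
    refine (pathExp_mono hk 0 m h1 x).trans ?_
    rw [pathExp_const_mul, pow_succ']
    exact mul_le_mul_of_nonneg_left ih hb

end

/-! ### Local lower bound for sums of independent Bernoulli variables -/

/-- The probability mass function of a sum of independent Bernoulli variables with success
probabilities `r 1, …, r t`. -/
def bernoulliSum (r : ℕ → ℝ) : ℕ → ℤ → ℝ
  | 0 => fun z => if z = 0 then 1 else 0
  | t + 1 => fun z => (1 - r (t + 1)) * bernoulliSum r t z + r (t + 1) * bernoulliSum r t (z - 1)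

section
variable {r : ℕ → ℝ}

lemma bernoulliSum_nonneg (hr : ∀ s, r s ∈ Set.Icc (0 : ℝ) 1) (t : ℕ) (z : ℤ) :
    0 ≤ bernoulliSum r t z := by
  induction t generalizing z with
  | zero => simp only [bernoulliSum]; split_ifs <;> norm_num
  | succ t ih =>
    exact add_nonneg (mul_nonneg (by linarith [(hr (t + 1)).2]) (ih z))
      (mul_nonneg (hr (t + 1)).1 (ih _))

lemma bernoulliSum_of_neg (t : ℕ) {z : ℤ} (hz : z < 0) : bernoulliSum r t z = 0 := by
  induction t generalizing z with
  | zero => simp [bernoulliSum, hz.ne]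
  | succ t ih => simp [bernoulliSum, ih hz, ih (show z - 1 < 0 by omega)]

lemma bernoulliSum_of_gt (t : ℕ) {z : ℤ} (hz : (t : ℤ) < z) : bernoulliSum r t z = 0 := by
  induction t generalizing z with
  | zero => simp only [bernoulliSum]; rw [if_neg (by simp at hz; omega)]
  | succ t ih =>
    push_cast at hz
    simp [bernoulliSum, ih (show (t : ℤ) < z by omega), ih (show (t : ℤ) < z - 1 by omega)]

lemma bernoulliSum_compl (t : ℕ) (z : ℤ) :
    bernoulliSum (fun s => 1 - r s) t z = bernoulliSum r t (t - z) := by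
  induction t generalizing z with
  | zero => simp [bernoulliSum]
  | succ t ih =>
    simp only [bernoulliSum, ih]
    push_cast
    rw [show (t : ℤ) - (z - 1) = t + 1 - z by ring, show (t : ℤ) + 1 - z - 1 = t - z by ring]
    ring

/-- Exponential tilting acts factor by factor: each Bernoulli law is weighted by `1` and `exp l` and
renormalised, and the normalisations multiply to the moment generating function. -/
lemma bernoulliSum_tilt (hr : ∀ s, r s ∈ Set.Icc (0 : ℝ) 1) (l : ℝ) (t : ℕ) (z : ℤ) :
    bernoulliSum (fun s => r s * Real.exp l / (1 - r s + r s * Real.exp l)) t z *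
      ∏ s ∈ Finset.Icc 1 t, (1 - r s + r s * Real.exp l) =
    bernoulliSum r t z * Real.exp (l * z) := by
  induction t generalizing z with
  | zero =>
    simp only [bernoulliSum]
    split_ifs with h <;> simp [h]
  | succ t ih =>
    rw [Finset.prod_Icc_succ_top (by omega)]
    simp only [bernoulliSum]
    set w := ∏ s ∈ Finset.Icc 1 t, (1 - r s + r s * Real.exp l)
    have hpos : 0 < 1 - r (t + 1) + r (t + 1) * Real.exp l := by
      have h0 := (hr (t + 1)).1
      have h1 := (hr (t + 1)).2
      have he := Real.exp_pos l
      rcases h0.eq_or_lt with h | h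
      · rw [← h]; norm_num
      · have := mul_pos h he; linarith
    have e1 := ih z
    have e2 := ih (z - 1)
    have e3 : Real.exp (l * z) = Real.exp l * Real.exp (l * (z - 1 : ℤ)) := by
      rw [← Real.exp_add]; congr 1; push_cast; ring
    set A := bernoulliSum (fun s => r s * Real.exp l / (1 - r s + r s * Real.exp l)) t z
    set B := bernoulliSum (fun s => r s * Real.exp l / (1 - r s + r s * Real.exp l)) t (z - 1)
    set d := 1 - r (t + 1) + r (t + 1) * Real.exp l with hd
    have : ((1 - r (t + 1) * Real.exp l / d) * A + r (t + 1) * Real.exp l / d * B) * (w * d) =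
        (1 - r (t + 1)) * (A * w) + r (t + 1) * Real.exp l * (B * w) := by
      field_simp
      rw [show d - r (t + 1) * Real.exp l = 1 - r (t + 1) by rw [hd]; ring]
      ring
    rw [this, e1, e2, e3]; ring

/-- Convolution with a Bernoulli law preserves log-concavity. After expansion, the `(1 - q) ^ 2` and
`q ^ 2` terms are instances of the induction hypothesis; in the mixed term one product is common to
both sides, and `a3` compares the remaining two. -/
lemma bernoulliSum_logConcave (hr : ∀ s, r s ∈ Set.Icc (0 : ℝ) 1) (t : ℕ) {m n : ℤ}
    (hmn : m ≤ n) :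
    bernoulliSum r t (m - 1) * bernoulliSum r t (n + 1) ≤
      bernoulliSum r t m * bernoulliSum r t n := by
  induction t generalizing m n with
  | zero =>
    simp only [bernoulliSum]
    split_ifs <;> first | omega | norm_num
  | succ t ih =>
    simp only [bernoulliSum]
    have h0 := (hr (t + 1)).1
    have h1 : 0 ≤ 1 - r (t + 1) := by linarith [(hr (t + 1)).2]
    set q := r (t + 1)
    rw [show n + 1 - 1 = n by ring]
    have a1 := ih hmn
    have a2 := ih (show m - 1 ≤ n - 1 by omega)
    rw [show n - 1 + 1 = n by ring] at a2
    have a3 : bernoulliSum r t (m - 1 - 1) * bernoulliSum r t (n + 1) ≤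
        bernoulliSum r t m * bernoulliSum r t (n - 1) := by
      have b1 := ih (show m - 1 ≤ n by omega)
      rcases hmn.eq_or_lt with rfl | h
      · linarith
      · have b2 := ih (show m ≤ n - 1 by omega)
        rw [show n - 1 + 1 = n by ring] at b2
        linarith
    nlinarith [mul_le_mul_of_nonneg_left a1 (mul_nonneg h1 h1),
      mul_le_mul_of_nonneg_left a2 (mul_nonneg h0 h0),
      mul_le_mul_of_nonneg_left a3 (mul_nonneg h0 h1)]

/-- A log-concave sequence has no dip. The interval is shrunk from either end; if both inner
neighbours were below `c`, their product would be less than that of the end values. -/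
lemma bernoulliSum_min_le (hr : ∀ s, r s ∈ Set.Icc (0 : ℝ) 1) (t : ℕ) {c : ℝ} {i j l : ℤ}
    (hij : i ≤ j) (hjl : j ≤ l) (hi : c ≤ bernoulliSum r t i) (hl : c ≤ bernoulliSum r t l) :
    c ≤ bernoulliSum r t j := by
  obtain ⟨d, hd⟩ : ∃ d : ℕ, l - i = d := ⟨(l - i).toNat, by omega⟩
  induction d using Nat.strong_induction_on generalizing i l with
  | _ d ih =>
    rcases hij.eq_or_lt with rfl | hij
    · exact hi
    rcases hjl.eq_or_lt with rfl | hjl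
    · exact hl
    have key := bernoulliSum_logConcave hr t (show i + 1 ≤ l - 1 by omega)
    rw [show i + 1 - 1 = i by ring, show l - 1 + 1 = l by ring] at key
    by_cases h : c ≤ bernoulliSum r t (i + 1)
    · exact ih (d - 1) (by omega) (by omega) hjl.le h hl (by omega)
    by_cases h' : c ≤ bernoulliSum r t (l - 1)
    · exact ih (d - 1) (by omega) hij.le (by omega) hi h' (by omega)
    exfalso
    push Not at h h'
    have p1 := bernoulliSum_nonneg hr t (i + 1)
    have p2 := bernoulliSum_nonneg hr t (l - 1)
    nlinarith

lemma sum_bernoulliSum_succ (t : ℕ) (φ : ℕ → ℝ) :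
    ∑ n ∈ Finset.range (t + 2), bernoulliSum r (t + 1) n * φ n =
      ∑ n ∈ Finset.range (t + 1),
        bernoulliSum r t n * ((1 - r (t + 1)) * φ n + r (t + 1) * φ (n + 1)) := by
  have h1 : ∑ n ∈ Finset.range (t + 2), bernoulliSum r t n * φ n =
      ∑ n ∈ Finset.range (t + 1), bernoulliSum r t n * φ n := by
    rw [Finset.sum_range_succ, bernoulliSum_of_gt t (by push_cast; omega), zero_mul, add_zero]
  have h2 : ∑ n ∈ Finset.range (t + 2), bernoulliSum r t ((n : ℤ) - 1) * φ n =
      ∑ n ∈ Finset.range (t + 1), bernoulliSum r t n * φ (n + 1) := by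
    rw [Finset.sum_range_succ', bernoulliSum_of_neg t (by norm_num), zero_mul, add_zero]
    refine Finset.sum_congr rfl fun n _ => ?_
    push_cast
    rw [add_sub_cancel_right]
  calc _ = ∑ n ∈ Finset.range (t + 2), ((1 - r (t + 1)) * (bernoulliSum r t n * φ n) +
        r (t + 1) * (bernoulliSum r t ((n : ℤ) - 1) * φ n)) :=
        Finset.sum_congr rfl fun n _ => by simp only [bernoulliSum]; ring
    _ = _ := by
        rw [Finset.sum_add_distrib, ← Finset.mul_sum, ← Finset.mul_sum, h1, h2, Finset.mul_sum,
          Finset.mul_sum, ← Finset.sum_add_distrib]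
        exact Finset.sum_congr rfl fun n _ => by ring

lemma sum_bernoulliSum_pow (u : ℝ) (t : ℕ) :
    ∑ n ∈ Finset.range (t + 1), bernoulliSum r t n * u ^ n =
      ∏ s ∈ Finset.Icc 1 t, (1 - r s + r s * u) := by
  induction t with
  | zero => simp [bernoulliSum]
  | succ t ih =>
    rw [Finset.prod_Icc_succ_top (by omega), ← ih, sum_bernoulliSum_succ t (fun n => u ^ n),
      Finset.sum_mul]
    exact Finset.sum_congr rfl fun n _ => by ring

lemma sum_bernoulliSum (t : ℕ) : ∑ n ∈ Finset.range (t + 1), bernoulliSum r t n = 1 := by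
  simpa using sum_bernoulliSum_pow (r := r) 1 t

lemma variance_bernoulliSum (t : ℕ) :
    ∑ n ∈ Finset.range (t + 1), bernoulliSum r t n * ((n : ℝ) - ∑ s ∈ Finset.Icc 1 t, r s) ^ 2 =
      ∑ s ∈ Finset.Icc 1 t, r s * (1 - r s) := by
  induction t with
  | zero => simp [bernoulliSum]
  | succ t ih =>
    rw [sum_bernoulliSum_succ t (fun n => ((n : ℝ) - ∑ s ∈ Finset.Icc 1 (t + 1), r s) ^ 2),
      Finset.sum_Icc_succ_top (by omega), Finset.sum_Icc_succ_top (by omega), ← ih]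
    set μ := ∑ s ∈ Finset.Icc 1 t, r s
    calc _ = ∑ n ∈ Finset.range (t + 1), (bernoulliSum r t n * ((n : ℝ) - μ) ^ 2 +
          bernoulliSum r t n * (r (t + 1) * (1 - r (t + 1)))) :=
          Finset.sum_congr rfl fun n _ => by push_cast; ring
      _ = _ := by rw [Finset.sum_add_distrib, ← Finset.sum_mul, sum_bernoulliSum, one_mul]

/-- By Chebyshev, with variance at most `t / 4`, at least `3 / 4` of the mass lies within `√t` of
the mean. This window contains at most `3 √t` integers, so they cannot all have mass below `1 / (8
√t)`. -/
lemma exists_bernoulliSum_ge (hr : ∀ s, r s ∈ Set.Icc (0 : ℝ) 1) {t : ℕ} (ht : 1 ≤ t) :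
    ∃ n : ℕ, |(n : ℝ) - ∑ s ∈ Finset.Icc 1 t, r s| ≤ √t ∧ 1 / (8 * √t) ≤ bernoulliSum r t n := by
  by_contra! hcon
  set μ := ∑ s ∈ Finset.Icc 1 t, r s with hμ
  have ht' : (1 : ℝ) ≤ t := by exact_mod_cast ht
  have hs1 : 1 ≤ √(t : ℝ) := Real.one_le_sqrt.2 ht'
  have hs2 : √(t : ℝ) ^ 2 = t := Real.sq_sqrt (by positivity)
  have hvar : ∑ s ∈ Finset.Icc 1 t, r s * (1 - r s) ≤ t / 4 := by
    calc _ ≤ ∑ s ∈ Finset.Icc 1 t, (1 / 4 : ℝ) :=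
          Finset.sum_le_sum fun s _ => by nlinarith [sq_nonneg (r s - 1 / 2)]
      _ = _ := by simp; ring
  have hsplit := Finset.sum_filter_add_sum_filter_not (Finset.range (t + 1))
    (fun n : ℕ => |(n : ℝ) - μ| ≤ √t) (fun n : ℕ => bernoulliSum r t n)
  rw [sum_bernoulliSum] at hsplit
  have hfar : ∑ n ∈ Finset.range (t + 1) with ¬ |((n : ℕ) : ℝ) - μ| ≤ √t, bernoulliSum r t n ≤
      1 / 4 := by
    calc _ ≤ ∑ n ∈ Finset.range (t + 1) with ¬ |((n : ℕ) : ℝ) - μ| ≤ √t,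
          bernoulliSum r t n * ((n : ℝ) - μ) ^ 2 / t := by
          refine Finset.sum_le_sum fun n hn => ?_
          have hn := not_le.1 (Finset.mem_filter.1 hn).2
          rw [le_div_iff₀ (by positivity)]
          refine mul_le_mul_of_nonneg_left ?_ (bernoulliSum_nonneg hr t n)
          rw [← hs2, ← sq_abs ((n : ℝ) - μ)]
          exact pow_le_pow_left₀ (by positivity) hn.le 2
      _ ≤ ∑ n ∈ Finset.range (t + 1), bernoulliSum r t n * ((n : ℝ) - μ) ^ 2 / t :=
          Finset.sum_le_sum_of_subset_of_nonneg (Finset.filter_subset _ _) fun n _ _ =>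
            div_nonneg (mul_nonneg (bernoulliSum_nonneg hr t n) (sq_nonneg _)) (by positivity)
      _ ≤ 1 / 4 := by
          rw [← Finset.sum_div, variance_bernoulliSum, div_le_iff₀ (by positivity)]
          linarith
  have hcard : (((Finset.range (t + 1)).filter fun n : ℕ => |(n : ℝ) - μ| ≤ √t).card : ℝ) ≤
      2 * √t + 1 := by
    have h1 : ((Finset.range (t + 1)).filter fun n : ℕ => |(n : ℝ) - μ| ≤ √t).card ≤
        (Finset.Icc ⌈μ - √t⌉ ⌊μ + √t⌋).card := by
      refine Finset.card_le_card_of_injOn (fun n => (n : ℤ)) (fun n hn => ?_)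
        (fun a _ b _ h => by simpa using h)
      have hn := abs_le.1 (Finset.mem_filter.1 (Finset.mem_coe.1 hn)).2
      simp only [Finset.coe_Icc, Set.mem_Icc]
      exact ⟨Int.ceil_le.2 (by push_cast; linarith), Int.le_floor.2 (by push_cast; linarith)⟩
    rw [Int.card_Icc] at h1
    have h2 : (((Finset.range (t + 1)).filter fun n : ℕ => |(n : ℝ) - μ| ≤ √t).card : ℝ) ≤
        ((⌊μ + √t⌋ + 1 - ⌈μ - √t⌉).toNat : ℝ) := by exact_mod_cast h1
    refine h2.trans ?_
    rcases le_total 0 (⌊μ + √t⌋ + 1 - ⌈μ - √t⌉) with h | h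
    · have : (((⌊μ + √t⌋ + 1 - ⌈μ - √t⌉).toNat : ℤ) : ℝ) = (⌊μ + √t⌋ + 1 - ⌈μ - √t⌉ : ℤ) := by
        rw [Int.toNat_of_nonneg h]
      rw [← Int.cast_natCast, this]
      push_cast
      linarith [Int.floor_le (μ + √t), Int.le_ceil (μ - √t)]
    · rw [Int.toNat_of_nonpos h]; simp; positivity
  have hnear : ∑ n ∈ Finset.range (t + 1) with |((n : ℕ) : ℝ) - μ| ≤ √t, bernoulliSum r t n ≤
      3 / 8 := by
    calc _ ≤ ∑ n ∈ Finset.range (t + 1) with |((n : ℕ) : ℝ) - μ| ≤ √t, 1 / (8 * √t) :=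
          Finset.sum_le_sum fun n hn => (hcon n (Finset.mem_filter.1 hn).2).le
      _ ≤ (3 * √t) * (1 / (8 * √t)) := by
          rw [Finset.sum_const, nsmul_eq_mul]
          exact mul_le_mul_of_nonneg_right (by linarith) (by positivity)
      _ = 3 / 8 := by field_simp
  linarith

lemma exp_mul_le_bernoulli_mgf {p l : ℝ} (hp : p ∈ Set.Icc (0 : ℝ) 1) :
    Real.exp (l * p) ≤ 1 - p + p * Real.exp l := by
  have := rpow_one_add_le_one_add_mul_self (s := Real.exp l - 1) (p := p)
    (by linarith [Real.exp_pos l]) hp.1 hp.2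
  rw [add_sub_cancel, ← Real.exp_mul] at this
  linarith

/-- Tilting by `l = γ / √t` moves the mean to the right by at least `l / 3` times the variance, thus
by at least `(Γ + 1) √t`, and by at most `2 l t`. The tilted law has a heavy point within `√t` of
its mean, and undoing the tilt costs only a constant factor. -/
lemma exists_bernoulliSum_ge_right (hr : ∀ s, r s ∈ Set.Icc (0 : ℝ) 1) {t : ℕ} (ht : 1 ≤ t)
    {κ γ Γ : ℝ} (hγ : 0 ≤ γ) (hγt : γ ≤ √t) (hΓ : Γ + 1 ≤ γ * κ / 3)
    (hV : κ * t ≤ ∑ s ∈ Finset.Icc 1 t, r s * (1 - r s)) :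
    ∃ z : ℤ, ∑ s ∈ Finset.Icc 1 t, r s + Γ * √t ≤ z ∧
      Real.exp (-(γ * (2 * γ + 1))) / 8 / √t ≤ bernoulliSum r t z := by
  have ht' : (1 : ℝ) ≤ t := by exact_mod_cast ht
  have hs1 : 1 ≤ √(t : ℝ) := Real.one_le_sqrt.2 ht'
  have hs0 : 0 < √(t : ℝ) := by linarith
  have hs2 : √(t : ℝ) * √t = t := Real.mul_self_sqrt (by positivity)
  set l := γ / √t with hl
  have hl0 : 0 ≤ l := by positivity
  have hl1 : l ≤ 1 := (div_le_one hs0).2 hγt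
  have hlt : l * t = γ * √t := by
    rw [hl, div_mul_eq_mul_div, div_eq_iff hs0.ne', mul_assoc, hs2]
  have hls : l * √t = γ := by rw [hl]; field_simp
  have he1 : 1 + l ≤ Real.exp l := by linarith [Real.add_one_le_exp l]
  have he2 : Real.exp l ≤ 1 + 2 * l := by
    have := Real.abs_exp_sub_one_le (x := l) (by rwa [abs_of_nonneg hl0])
    rw [abs_of_nonneg hl0] at this
    linarith [le_abs_self (Real.exp l - 1)]
  set r' : ℕ → ℝ := fun s => r s * Real.exp l / (1 - r s + r s * Real.exp l) with hr'
  have hd : ∀ s, 1 ≤ 1 - r s + r s * Real.exp l := fun s => by nlinarith [(hr s).1]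
  have hd' : ∀ s, 1 - r s + r s * Real.exp l ≤ 3 := fun s => by nlinarith [(hr s).1, (hr s).2]
  have hr'1 : ∀ s, r' s ∈ Set.Icc (0 : ℝ) 1 := fun s =>
    ⟨div_nonneg (mul_nonneg (hr s).1 (Real.exp_pos l).le) (by linarith [hd s]),
      (div_le_one (by linarith [hd s])).2 (by linarith [(hr s).2])⟩
  have hdiff : ∀ s, r' s - r s = r s * (1 - r s) * (Real.exp l - 1) /
      (1 - r s + r s * Real.exp l) := fun s => by
    have := hd s
    simp only [hr']
    rw [eq_div_iff (by linarith), sub_mul, div_mul_cancel₀ _ (by linarith)]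
    ring
  have hv : ∀ s, 0 ≤ r s * (1 - r s) := fun s => mul_nonneg (hr s).1 (by linarith [(hr s).2])
  have hlow : ∀ s, l / 3 * (r s * (1 - r s)) ≤ r' s - r s := fun s => by
    rw [hdiff, le_div_iff₀ (by linarith [hd s])]
    have h1 := mul_le_mul_of_nonneg_left (hd' s) (mul_nonneg hl0 (hv s))
    have h2 := mul_le_mul_of_nonneg_left (show l ≤ Real.exp l - 1 by linarith) (hv s)
    nlinarith
  have hup : ∀ s, r' s - r s ≤ 2 * l := fun s => by
    rw [hdiff, div_le_iff₀ (by linarith [hd s])]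
    have h1 : r s * (1 - r s) ≤ 1 := by nlinarith [(hr s).1, (hr s).2]
    have h2 := mul_le_mul h1 (show Real.exp l - 1 ≤ 2 * l by linarith) (by linarith) zero_le_one
    have h3 := mul_le_mul_of_nonneg_left (hd s) (show 0 ≤ 2 * l by linarith)
    linarith
  obtain ⟨n, hn, hpn⟩ := exists_bernoulliSum_ge hr'1 ht
  set μ := ∑ s ∈ Finset.Icc 1 t, r s
  have hμ1 : l / 3 * (κ * t) ≤ ∑ s ∈ Finset.Icc 1 t, r' s - μ := by
    rw [← Finset.sum_sub_distrib]
    refine le_trans (mul_le_mul_of_nonneg_left hV (by positivity)) ?_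
    rw [Finset.mul_sum]
    exact Finset.sum_le_sum fun s _ => hlow s
  have hμ2 : ∑ s ∈ Finset.Icc 1 t, r' s - μ ≤ 2 * l * t := by
    rw [← Finset.sum_sub_distrib]
    refine (Finset.sum_le_sum fun s _ => hup s).trans ?_
    simp [mul_comm]
  have hn := abs_le.1 hn
  refine ⟨n, ?_, ?_⟩
  · have : l / 3 * (κ * t) = γ * κ / 3 * √t := by
      rw [show l / 3 * (κ * t) = κ / 3 * (l * t) by ring, hlt]; ring
    have h3 := mul_le_mul_of_nonneg_right hΓ hs0.le
    push_cast
    nlinarith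
  · have hG : Real.exp (l * μ) ≤ ∏ s ∈ Finset.Icc 1 t, (1 - r s + r s * Real.exp l) := by
      rw [Finset.mul_sum, Real.exp_sum]
      -- The normalisation is at least `exp (l μ)` by Jensen, so only the displacement `n - μ`
      -- enters the cost.
      exact Finset.prod_le_prod (fun s _ => (Real.exp_pos _).le)
        fun s _ => exp_mul_le_bernoulli_mgf (hr s)
    have htilt := bernoulliSum_tilt hr l t n
    have h1 : 1 / (8 * √t) * Real.exp (l * μ) ≤ bernoulliSum r t n * Real.exp (l * (n : ℤ)) := by
      rw [← htilt]
      exact mul_le_mul hpn hG (Real.exp_pos _).le (bernoulliSum_nonneg hr'1 t n)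
    have h2 : Real.exp (l * μ) = Real.exp (l * (n : ℤ)) * Real.exp (-(l * (n - μ))) := by
      rw [← Real.exp_add]; congr 1; push_cast; ring
    have h3 : -(γ * (2 * γ + 1)) ≤ -(l * (n - μ)) := by
      have : l * (n - μ) ≤ l * (2 * l * t + √t) := mul_le_mul_of_nonneg_left (by linarith) hl0
      rw [show l * (2 * l * t + √t) = 2 * l * (l * t) + l * √t by ring, hlt, hls,
        show 2 * l * (γ * √t) = 2 * γ * (l * √t) by ring, hls] at this
      linarith
    have h4 : 1 / (8 * √t) * Real.exp (-(l * (n - μ))) ≤ bernoulliSum r t n := by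
      rw [h2] at h1
      have h5 := Real.exp_pos (l * (n : ℤ))
      refine le_of_mul_le_mul_right ?_ h5
      linarith
    refine le_trans ?_ h4
    rw [div_div, div_eq_mul_one_div, mul_comm]
    exact mul_le_mul_of_nonneg_left (Real.exp_le_exp.2 h3) (by positivity)

/-- Local lower bound: a sum of independent Bernoulli variables whose variance is at least `κ t`
puts mass of order `1 / √t` on every point within `Γ √t` of its mean. -/
lemma exists_local_lower_bound {κ : ℝ} (hκ : 0 < κ) {Γ : ℝ} (hΓ : 0 ≤ Γ) :
    ∃ c : ℝ, 0 < c ∧ ∃ T : ℕ, 1 ≤ T ∧ ∀ (r : ℕ → ℝ), (∀ s, r s ∈ Set.Icc (0 : ℝ) 1) → ∀ t : ℕ,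
      T ≤ t → κ * t ≤ ∑ s ∈ Finset.Icc 1 t, r s * (1 - r s) → ∀ z : ℤ,
      |(z : ℝ) - ∑ s ∈ Finset.Icc 1 t, r s| ≤ Γ * √t → c / √t ≤ bernoulliSum r t z := by
  set γ := 3 * (Γ + 1) / κ with hγ
  have hγ0 : 0 ≤ γ := by positivity
  have hγκ : Γ + 1 ≤ γ * κ / 3 := by rw [hγ]; field_simp; rfl
  refine ⟨Real.exp (-(γ * (2 * γ + 1))) / 8, by positivity, ⌈γ ^ 2⌉₊ + 1, by omega, ?_⟩
  intro r hr t ht hV z hz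
  have ht1 : 1 ≤ t := by omega
  have hγt : γ ≤ √t := by
    refine Real.le_sqrt_of_sq_le ((Nat.le_ceil _).trans ?_)
    exact_mod_cast (Nat.le_succ _).trans ht
  obtain ⟨z₁, h1, h1'⟩ := exists_bernoulliSum_ge_right hr ht1 hγ0 hγt hγκ hV
  obtain ⟨z₂, h2, h2'⟩ := exists_bernoulliSum_ge_right (r := fun s => 1 - r s)
    (fun s => ⟨by linarith [(hr s).2], by linarith [(hr s).1]⟩) ht1 hγ0 hγt hγκ
    (hV.trans_eq (Finset.sum_congr rfl fun s _ => by ring))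
  rw [bernoulliSum_compl] at h2'
  rw [Finset.sum_sub_distrib] at h2
  simp only [Finset.sum_const, Nat.card_Icc, add_tsub_cancel_right, nsmul_eq_mul, mul_one] at h2
  have hz := abs_le.1 hz
  -- One heavy point lies to the right of the window; exchanging successes and failures gives one to
  -- its left. Log-concavity fills in everything between them.
  refine bernoulliSum_min_le hr t (i := t - z₂) (l := z₁) ?_ ?_ h2' h1'
  · have : ((t : ℤ) - z₂ : ℝ) ≤ z := by push_cast; linarith
    exact_mod_cast this
  · have : (z : ℝ) ≤ z₁ := by linarith
    exact_mod_cast this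

end

/-! ### The law of the Bernoulli sum as a recursively defined mass function -/

instance (r : ℕ → unitInterval) (t : ℕ) : IsProbabilityMeasure (bernoulliSumLaw r t) :=
  Measure.isProbabilityMeasure_map (by fun_prop)

lemma integral_pow_bernoulliSumLaw (r : ℕ → unitInterval) (t : ℕ) (u : ℝ) :
    ∫ z, u ^ z ∂(bernoulliSumLaw r t) = ∏ s ∈ Finset.Icc 1 t, (1 - (r s : ℝ) + r s * u) := by
  rw [bernoulliSumLaw, integral_map (by fun_prop) (by fun_prop)]
  simp only [← Finset.prod_pow_eq_pow_sum]
  rw [integral_fintype_prod_eq_prod (f := fun _ (z : ℕ) => u ^ z),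
    ← Finset.prod_coe_sort (Finset.Icc 1 t)]
  refine Finset.prod_congr rfl fun s _ => ?_
  rw [integral_bernoulliMeasure]
  simp
  ring

lemma bernoulliSumLaw_le (r : ℕ → unitInterval) (t : ℕ) :
    ∀ᵐ z ∂(bernoulliSumLaw r t), z ∈ Finset.range (t + 1) := by
  rw [bernoulliSumLaw, ae_map_iff (by fun_prop) (by measurability)]
  have : ∀ᵐ x ∂(Measure.pi fun s : Finset.Icc 1 t => bernoulliMeasure (1 : ℕ) 0 (r s)),
      ∀ s, x s ≤ 1 := by
    rw [ae_all_iff]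
    intro s
    have h : ∀ᵐ y ∂(bernoulliMeasure (1 : ℕ) 0 (r s)), y ≤ 1 := by
      rw [ae_iff, bernoulliMeasure_apply_of_notMem_of_notMem] <;> simp
    exact (measurePreserving_eval
      (fun s : Finset.Icc 1 t => bernoulliMeasure (1 : ℕ) 0 (r s)) s).quasiMeasurePreserving.ae h
  filter_upwards [this] with x hx
  have := Finset.sum_le_sum fun s (_ : s ∈ Finset.univ) => hx s
  simp at this
  simp
  omega

/-- Both mass functions are supported in `0, …, t` and have the same generating polynomial, so the
coefficients agree. -/
lemma bernoulliSumLaw_real_singleton (r : ℕ → unitInterval) (t z : ℕ) :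
    (bernoulliSumLaw r t).real {z} = bernoulliSum (fun s => r s) t z := by
  by_cases hz : z ∈ Finset.range (t + 1)
  swap
  · rw [bernoulliSum_of_gt t (by simp at hz; omega), measureReal_eq_zero_iff]
    exact measure_mono_null (fun y hy => by simpa [Set.mem_singleton_iff.1 hy] using hz)
      (ae_iff.1 (bernoulliSumLaw_le r t))
  have hint : ∀ u : ℝ, ∫ z, u ^ z ∂(bernoulliSumLaw r t) =
      ∑ n ∈ Finset.range (t + 1), (bernoulliSumLaw r t).real {n} * u ^ n := by
    intro u
    have h := setIntegral_finset (μ := bernoulliSumLaw r t) (f := fun z => u ^ z)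
      (Finset.range (t + 1)) IntegrableOn.finset
    rw [Measure.restrict_eq_self_of_ae_mem (bernoulliSumLaw_le r t)] at h
    simpa using h
  have hpoly : (∑ n ∈ Finset.range (t + 1), Polynomial.C ((bernoulliSumLaw r t).real {n}) *
      Polynomial.X ^ n) = ∑ n ∈ Finset.range (t + 1),
        Polynomial.C (bernoulliSum (fun s => r s) t n) * Polynomial.X ^ n := by
    refine Polynomial.funext fun u => ?_
    simp only [Polynomial.eval_finsetSum, Polynomial.eval_mul, Polynomial.eval_C,
      Polynomial.eval_pow, Polynomial.eval_X]
    rw [← hint, integral_pow_bernoulliSumLaw, sum_bernoulliSum_pow]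
  have := congrArg (fun P => Polynomial.coeff P z) hpoly
  simp only [Polynomial.finsetSum_coeff, Polynomial.coeff_C_mul, Polynomial.coeff_X_pow] at this
  simpa [hz, Finset.sum_ite_eq] using this

/-! ### Equilibrium and regret in normalised form -/

/-- A strict preference of one player forces a pure action, which makes the opponent's preference
strict; the resulting pure reply contradicts the first preference, since best replies cycle. So both
players are indifferent, and indifference excludes the endpoints. -/
lemma IsNashEquilibrium.interior {G H : Payoff} (hGH : IsCompetitive G H) {p q : unitInterval}
    (h : IsNashEquilibrium G H p q) :
    (0 < (p : ℝ) ∧ (p : ℝ) < 1 ∧ 0 < (q : ℝ) ∧ (q : ℝ) < 1) ∧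
    (1 - (q : ℝ)) * (G 1 0 - G 0 0) + q * (G 1 1 - G 0 1) = 0 ∧
    (1 - (p : ℝ)) * (H 0 1 - H 0 0) + p * (H 1 1 - H 1 0) = 0 := by
  obtain ⟨h1, h2⟩ := h
  have a0 := h1 0
  have a1 := h1 1
  have b0 := h2 0
  have b1 := h2 1
  simp only [mixedPayoff, Set.Icc.coe_zero, Set.Icc.coe_one] at a0 a1 b0 b1
  obtain ⟨p, p0, p1⟩ := p
  obtain ⟨q, q0, q1⟩ := q
  simp only at *
  set s := (1 - q) * (G 1 0 - G 0 0) + q * (G 1 1 - G 0 1) with hs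
  set w := (1 - p) * (H 0 1 - H 0 0) + p * (H 1 1 - H 1 0) with hw
  have a0' : 0 ≤ p * s := by rw [hs]; linarith
  have a1' : (1 - p) * s ≤ 0 := by rw [hs]; linarith
  have b0' : 0 ≤ q * w := by rw [hw]; linarith
  have b1' : (1 - q) * w ≤ 0 := by rw [hw]; linarith
  clear_value s w
  clear a0 a1 b0 b1 h1 h2
  have sp : 0 < s → p = 1 := fun h => by nlinarith
  have sn : s < 0 → p = 0 := fun h => by nlinarith
  have wp : 0 < w → q = 1 := fun h => by nlinarith
  have wn : w < 0 → q = 0 := fun h => by nlinarith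
  have hs0 : s = 0 := by
    rcases lt_trichotomy s 0 with h | h | h
    · have hp := sn h
      subst hp
      rcases hGH with hc | hc
      · have := wp (by linarith)
        subst this; linarith
      · have := wn (by linarith)
        subst this; linarith
    · exact h
    · have hp := sp h
      subst hp
      rcases hGH with hc | hc
      · have := wn (by linarith)
        subst this; linarith
      · have := wp (by linarith)
        subst this; linarith
  have hq0 : q ≠ 0 := by
    rintro rfl
    rcases hGH with hc | hc <;> linarith
  have hq1 : q ≠ 1 := by
    rintro rfl
    rcases hGH with hc | hc <;> linarith
  have hw0 : w = 0 := by
    rcases lt_trichotomy w 0 with h | h | h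
    · exact absurd (wn h) hq0
    · exact h
    · exact absurd (wp h) hq1
  have hp0 : p ≠ 0 := by
    rintro rfl
    rcases hGH with hc | hc <;> linarith
  have hp1 : p ≠ 1 := by
    rintro rfl
    rcases hGH with hc | hc <;> linarith
  exact ⟨⟨p0.lt_of_ne' hp0, p1.lt_of_ne hp1, q0.lt_of_ne' hq0, q1.lt_of_ne hq1⟩, hs0, hw0⟩

lemma sum_Icc_one_eq_sum_range (f : ℕ → ℝ) (T : ℕ) :
    ∑ t ∈ Finset.Icc 1 T, f t = ∑ t ∈ Finset.range T, f (t + 1) := by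
  induction T with
  | zero => simp
  | succ T ih => rw [Finset.sum_Icc_succ_top (by omega), Finset.sum_range_succ, ih]

/-- The number of times that action `1` is played in the rounds `1, …, T`, minus `T q`. -/
def excess (q : ℝ) (x : ℕ → Fin 2) (T : ℕ) : ℝ :=
  ∑ t ∈ Finset.range T, (((x (t + 1) : ℕ) : ℝ) - q)

/-- The payoff of action `0` cancels, so regret depends on the payoffs only through the difference
of the two actions. -/
lemma regret_eq {A : Payoff} {D q : ℝ} (hA : ∀ j, A 1 j - A 0 j = D * (((j : ℕ) : ℝ) - q))
    (σ : ℕ → (ℕ → Fin 2) → unitInterval) (x : ℕ → Fin 2) (T : ℕ) :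
    regret A σ x T = max 0 (D * excess q x T) -
      D * ∑ t ∈ Finset.range T, (σ (t + 1) x : ℝ) * (((x (t + 1) : ℕ) : ℝ) - q) := by
  have hA' : ∀ j, A 1 j = A 0 j + D * (((j : ℕ) : ℝ) - q) := fun j => by linarith [hA j]
  simp only [regret, sum_Icc_one_eq_sum_range, excess, hA']
  rw [Finset.sum_add_distrib, ← Finset.mul_sum]
  set S := ∑ t ∈ Finset.range T, A 0 (x (t + 1))
  set N := ∑ t ∈ Finset.range T, (((x (t + 1) : ℕ) : ℝ) - q)
  have h1 : max S (S + D * N) = S + max 0 (D * N) := by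
    conv_lhs => rw [← add_zero S, add_assoc, zero_add, max_add_add_left]
  have h2 : ∑ t ∈ Finset.range T, ((1 - (σ (t + 1) x : ℝ)) * A 0 (x (t + 1)) +
      (σ (t + 1) x : ℝ) * (A 0 (x (t + 1)) + D * (((x (t + 1) : ℕ) : ℝ) - q))) =
      S + D * ∑ t ∈ Finset.range T, (σ (t + 1) x : ℝ) * (((x (t + 1) : ℕ) : ℝ) - q) := by
    rw [Finset.mul_sum, ← Finset.sum_add_distrib]
    exact Finset.sum_congr rfl fun t _ => by ring
  rw [h1, h2]; ring

/-- A regret rate `(1 / 2, c)` in a game with indifference point `q`, up to the scale of the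
payoffs. -/
lemma HasRegretRate.exists_bound {A : Payoff} {d e q c : ℝ} (hd : 0 < d)
    (hA : ∀ j, A 1 j - A 0 j = d * e * (((j : ℕ) : ℝ) - q))
    {σ : ℕ → (ℕ → Fin 2) → unitInterval} (h : HasRegretRate A σ (1 / 2) c) :
    ∃ C : ℝ, ∃ T₀ : ℕ, ∀ T, T₀ ≤ T → ∀ x : ℕ → Fin 2,
      max 0 (e * excess q x T) -
        e * ∑ t ∈ Finset.range T, (σ (t + 1) x : ℝ) * (((x (t + 1) : ℕ) : ℝ) - q) ≤ C * √T := by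
  have h1 : limsup (fun T : ℕ => ⨆ x : ℕ → Fin 2,
      ((regret A σ x T / (T : ℝ) ^ (1 / 2 : ℝ) : ℝ) : EReal)) atTop < ((c + 1 : ℝ) : EReal) :=
    lt_of_le_of_lt h (by exact_mod_cast lt_add_one c)
  obtain ⟨T₀, hT₀⟩ := eventually_atTop.1 (eventually_lt_of_limsup_lt h1)
  -- The extra `1` in `c + 1` makes the limsup bound strict, hence eventually valid uniformly in the
  -- sequence; `T₀ + 1` ensures `T > 0`.
  refine ⟨(c + 1) / d, T₀ + 1, fun T hT x => ?_⟩
  have h2 := lt_of_le_of_lt (le_iSup (fun x : ℕ → Fin 2 =>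
      ((regret A σ x T / (T : ℝ) ^ (1 / 2 : ℝ) : ℝ) : EReal)) x) (hT₀ T (by omega))
  have h3 : regret A σ x T / √T < c + 1 := by
    rw [← Real.sqrt_eq_rpow] at h2; exact_mod_cast h2
  have hTpos : (0 : ℝ) < T := by exact_mod_cast (show 0 < T by omega)
  rw [div_lt_iff₀ (Real.sqrt_pos.2 hTpos), regret_eq hA] at h3
  rw [div_mul_eq_mul_div, le_div_iff₀ hd]
  have h4 : max 0 (d * e * excess q x T) = d * max 0 (e * excess q x T) := by
    rw [mul_max_of_nonneg _ _ hd.le, mul_zero, mul_assoc]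
  rw [h4] at h3
  linarith

lemma empAvg_congr {x y : ℕ → Fin 2} {t : ℕ} (h : ∀ s ∈ Set.Icc 1 t, x s = y s) :
    empAvg x t = empAvg y t := by
  apply Subtype.ext
  simp only [empAvg]
  congr 1
  exact Finset.sum_congr rfl fun s hs => by rw [h s (Finset.mem_Icc.1 hs)]

/-! ### The play as a transition kernel -/

/-- The transition probabilities of the game played with the strategies `f` and `g`. -/
def playKernel (f g : MeanBasedStrategy) (t : ℕ) (x : ℕ → Fin 2 × Fin 2) (a : Fin 2 × Fin 2) : ℝ :=
  actionProb (response f t fun s => (x s).2) a.1 * actionProb (response g t fun s => (x s).1) a.2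

lemma actionProb_nonneg (p : unitInterval) (a : Fin 2) : 0 ≤ actionProb p a := by
  unfold actionProb; split_ifs
  · exact p.2.1
  · linarith [p.2.2]

lemma response_snd_congr (f : MeanBasedStrategy) {t : ℕ} {x y : ℕ → Fin 2 × Fin 2}
    (h : ∀ s ∈ Set.Icc 1 t, x s = y s) :
    response f (t + 1) (fun s => (x s).2) = response f (t + 1) (fun s => (y s).2) :=
  congrArg (f (t + 1)) (empAvg_congr fun s hs => by rw [h s hs])

lemma response_fst_congr (f : MeanBasedStrategy) {t : ℕ} {x y : ℕ → Fin 2 × Fin 2}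
    (h : ∀ s ∈ Set.Icc 1 t, x s = y s) :
    response f (t + 1) (fun s => (x s).1) = response f (t + 1) (fun s => (y s).1) :=
  congrArg (f (t + 1)) (empAvg_congr fun s hs => by rw [h s hs])

lemma isTransition_playKernel (f g : MeanBasedStrategy) : IsTransition (playKernel f g) where
  nonneg t x a := mul_nonneg (actionProb_nonneg _ _) (actionProb_nonneg _ _)
  sum_eq_one t x := by
    simp only [playKernel, Fintype.sum_prod_type, Fin.sum_univ_two, actionProb]
    norm_num
    ring
  past t a := fun x y h => by
    simp only [playKernel, response_snd_congr f h, response_fst_congr g h]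

section bridge
variable {α : Type*} [Fintype α] {k : ℕ → (ℕ → α) → α → ℝ}

open Classical in
lemma pathExp_history (hk : IsTransition k) (m : ℕ) (x' x : ℕ → α) :
    pathExp k 0 m (fun y => if ∀ s ∈ Finset.Icc 1 m, y s = x' s then 1 else 0) x =
      ∏ t ∈ Finset.Icc 1 m, k t x' (x' t) := by
  induction m with
  | zero => simp
  | succ m ih =>
    rw [pathExp_succ, Finset.prod_Icc_succ_top (by omega), ← ih, mul_comm, ← pathExp_const_mul]
    refine congrFun (congrArg _ (funext fun y => ?_)) x
    rw [stepExp_apply, zero_add]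
    have hiff : ∀ a, (∀ s ∈ Finset.Icc 1 (m + 1), Function.update y (m + 1) a s = x' s) ↔
        (∀ s ∈ Finset.Icc 1 m, y s = x' s) ∧ a = x' (m + 1) := by
      intro a
      constructor
      · intro h
        refine ⟨fun s hs => ?_, ?_⟩
        · have hs := Finset.mem_Icc.1 hs
          have := h s (Finset.mem_Icc.2 ⟨hs.1, by omega⟩)
          rwa [Function.update_of_ne (by omega)] at this
        · simpa using h (m + 1) (Finset.mem_Icc.2 ⟨by omega, le_rfl⟩)
      · rintro ⟨h, rfl⟩ s hs
        have hs := Finset.mem_Icc.1 hs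
        rcases eq_or_ne s (m + 1) with rfl | hne
        · simp
        · rw [Function.update_of_ne hne]; exact h s (Finset.mem_Icc.2 ⟨hs.1, by omega⟩)
    simp only [hiff]
    by_cases h : ∀ s ∈ Finset.Icc 1 m, y s = x' s
    · have hk' := hk.past m (x' (m + 1)) (x := y) (y := x')
        (fun s hs => h s (Finset.mem_Icc.2 hs))
      simp only at hk'
      rw [if_pos h, mul_one, Finset.sum_eq_single (x' (m + 1))]
      · rw [if_pos ⟨h, rfl⟩, mul_one]; exact hk'
      · intro b _ hb
        rw [if_neg fun hc => hb hc.2, mul_zero]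
      · simp
    · rw [if_neg h, mul_zero]
      exact Finset.sum_eq_zero fun a _ => by rw [if_neg fun hc => h hc.1, mul_zero]

end bridge

section play
variable {Ω : Type*} [MeasurableSpace Ω] {μ : Measure Ω} [IsProbabilityMeasure μ]
  {f g : MeanBasedStrategy} {I J : ℕ → Ω → Fin 2}

lemma IsPlay.real_historyEvent (h : IsPlay μ f g I J) (x : ℕ → Fin 2 × Fin 2) (T : ℕ) :
    μ.real (historyEvent I J T (fun s => (x s).1) fun s => (x s).2) =
      ∏ t ∈ Finset.Icc 1 T, playKernel f g t x (x t) := by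
  induction T with
  | zero => simp [historyEvent]
  | succ T ih =>
    rw [h.history (T + 1) (by omega), Finset.prod_Icc_succ_top (by omega), Nat.add_sub_cancel, ih]
    rfl

/-- Expectations of functions of finitely many rounds of the play. -/
lemma IsPlay.integral_eq (h : IsPlay μ f g I J) {T : ℕ} {F : (ℕ → Fin 2 × Fin 2) → ℝ}
    (hF : DependsOn F (Set.Icc 1 T)) (x : ℕ → Fin 2 × Fin 2) :
    ∫ ω, F (fun s => (I s ω, J s ω)) ∂μ = pathExp (playKernel f g) 0 T F x := by
  classical
  -- The value `0` outside the rounds `1, …, T` is immaterial, since `F` does not see them.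
  let ext' : (Finset.Icc 1 T → Fin 2 × Fin 2) → ℕ → Fin 2 × Fin 2 := fun y s =>
    if hs : s ∈ Finset.Icc 1 T then y ⟨s, hs⟩ else 0
  have hext : ∀ y s (hs : s ∈ Finset.Icc 1 T), ext' y s = y ⟨s, hs⟩ := fun y s hs => dif_pos hs
  let res : Ω → Finset.Icc 1 T → Fin 2 × Fin 2 := fun ω s => (I s ω, J s ω)
  have hres : Measurable res := measurable_pi_lambda _ fun s =>
    (h.measurable_fst s).prodMk (h.measurable_snd s)
  have h1 : ∀ ω, F (fun s => (I s ω, J s ω)) = F (ext' (res ω)) := fun ω =>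
    hF fun s hs => by rw [hext _ s (Finset.mem_Icc.2 hs)]
  have h2 : F = fun y => ∑ z : Finset.Icc 1 T → Fin 2 × Fin 2,
      F (ext' z) * (if ∀ s ∈ Finset.Icc 1 T, y s = ext' z s then 1 else 0) := by
    ext y
    rw [Finset.sum_eq_single (fun s : Finset.Icc 1 T => y s)]
    · have hy : ∀ s ∈ Finset.Icc 1 T, y s = ext' (fun s : Finset.Icc 1 T => y s) s :=
        fun s hs => (hext (fun s : Finset.Icc 1 T => y s) s hs).symm
      rw [if_pos hy, mul_one]
      exact hF fun s hs => hy s (Finset.mem_Icc.2 hs)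
    · intro z _ hz
      rw [if_neg, mul_zero]
      intro hc
      exact hz (funext fun s => by rw [hc s s.2, hext _ _ s.2])
    · simp
  have := Measure.isProbabilityMeasure_map (μ := μ) hres.aemeasurable
  calc _ = ∫ ω, F (ext' (res ω)) ∂μ := integral_congr_ae (Eventually.of_forall h1)
    _ = ∫ z, F (ext' z) ∂(μ.map res) := (integral_map hres.aemeasurable
        (Measurable.of_discrete.aestronglyMeasurable (f := fun z => F (ext' z)))).symm
    _ = ∑ z, (μ.map res).real {z} • F (ext' z) := integral_fintype Integrable.of_finite
    _ = ∑ z, F (ext' z) * pathExp (playKernel f g) 0 T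
          (fun y => if ∀ s ∈ Finset.Icc 1 T, y s = ext' z s then 1 else 0) x := by
        refine Finset.sum_congr rfl fun z _ => ?_
        rw [pathExp_history (isTransition_playKernel f g), ← h.real_historyEvent,
          map_measureReal_apply hres (measurableSet_singleton z), smul_eq_mul, mul_comm]
        congr 2
        ext ω
        simp only [Set.mem_preimage, Set.mem_singleton_iff, historyEvent, Set.mem_ofPred_eq]
        constructor
        · rintro rfl s hs
          simp only [hext _ s hs]
          exact ⟨rfl, rfl⟩
        · intro hc
          funext s
          have := hc s s.2
          rw [hext _ _ s.2] at this
          exact Prod.ext this.1 this.2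
    _ = _ := by
        conv_rhs => rw [h2]
        rw [pathExp_sum]
        exact Finset.sum_congr rfl fun z _ => (pathExp_const_mul _ _ _ _ _).symm

end play

/-! ### Tilting player 1's actions -/

section tilt
variable {f g : MeanBasedStrategy}

/-- The likelihood ratio of one round when player 1 deviates from his strategy in proportion to
the deviation of player 2's mixed strategy from `q`. -/
def tiltRatio (f g : MeanBasedStrategy) (q l : ℝ) (t : ℕ) (x : ℕ → Fin 2 × Fin 2)
    (a : Fin 2 × Fin 2) : ℝ :=
  1 + l * ((response g t fun s => (x s).1 : ℝ) - q) *
    (((a.1 : ℕ) : ℝ) - (response f t fun s => (x s).2 : ℝ))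

lemma tiltRatio_dependsOn (q l : ℝ) (t : ℕ) (a : Fin 2 × Fin 2) :
    DependsOn (fun x => tiltRatio f g q l (t + 1) x a) (Set.Icc 1 t) := fun x y h => by
  simp only [tiltRatio, response_snd_congr f h, response_fst_congr g h]

/-- The correction has conditional mean zero because `a.1` has mean `P`, and it is at most one in
absolute value because `|l| ≤ 1`. -/
lemma isTransition_tilt {q l : ℝ} (hq : q ∈ Set.Icc (0 : ℝ) 1) (hl : |l| ≤ 1) :
    IsTransition fun t x a => playKernel f g t x a * tiltRatio f g q l t x a where
  nonneg t x a := by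
    refine mul_nonneg ((isTransition_playKernel f g).nonneg t x a) ?_
    unfold tiltRatio
    set Q := response g t fun s => (x s).1
    set P := response f t fun s => (x s).2
    have h1 : |(Q : ℝ) - q| ≤ 1 := abs_le.2 ⟨by linarith [Q.2.1, hq.2], by linarith [Q.2.2, hq.1]⟩
    have h2 : |((a.1 : ℕ) : ℝ) - P| ≤ 1 := by
      have : ((a.1 : ℕ) : ℝ) ≤ 1 := by exact_mod_cast (show (a.1 : ℕ) ≤ 1 by omega)
      have h0 : (0 : ℝ) ≤ ((a.1 : ℕ) : ℝ) := Nat.cast_nonneg _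
      exact abs_le.2 ⟨by linarith [P.2.2], by linarith [P.2.1]⟩
    have h3 : |l * ((Q : ℝ) - q) * (((a.1 : ℕ) : ℝ) - P)| ≤ 1 := by
      rw [abs_mul, abs_mul]
      exact mul_le_one₀ (mul_le_one₀ hl (abs_nonneg _) h1) (abs_nonneg _) h2
    linarith [(abs_le.1 h3).1]
  sum_eq_one t x := by
    simp only [playKernel, tiltRatio, Fintype.sum_prod_type, Fin.sum_univ_two, actionProb]
    norm_num
    ring
  past t a := fun x y h => by
    have h1 := (isTransition_playKernel f g).past t a h
    have h2 := tiltRatio_dependsOn (f := f) (g := g) q l t a h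
    simp only at h1 h2
    simp only [h1, h2]

/-- The cross term vanishes, and the second moment is `1 + l ^ 2 (Q - q) ^ 2 P (1 - P)`. -/
lemma sum_playKernel_tiltRatio_sq_le {q l : ℝ} (hq : q ∈ Set.Icc (0 : ℝ) 1) (t : ℕ)
    (x : ℕ → Fin 2 × Fin 2) :
    ∑ a, playKernel f g t x a * tiltRatio f g q l t x a ^ 2 ≤ 1 + l ^ 2 := by
  simp only [playKernel, tiltRatio, Fintype.sum_prod_type, Fin.sum_univ_two, actionProb]
  set Q := response g t fun s => (x s).1
  set P := response f t fun s => (x s).2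
  have h1 : ((Q : ℝ) - q) ^ 2 ≤ 1 := by
    nlinarith [Q.2.1, hq.2, Q.2.2, hq.1]
  have h2 : (P : ℝ) * (1 - P) ≤ 1 := by nlinarith [P.2.1, P.2.2]
  have h3 : 0 ≤ (P : ℝ) * (1 - P) := mul_nonneg P.2.1 (by linarith [P.2.2])
  have h4 : ((Q : ℝ) - q) ^ 2 * (P * (1 - P)) ≤ 1 := mul_le_one₀ h1 h3 h2
  have h5 := mul_le_mul_of_nonneg_left h4 (sq_nonneg l)
  norm_num
  nlinarith

/-- Adding up the two regret bounds: the game is strategically zero-sum. -/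
lemma regret_sum_bound {p q e : ℝ} (hp : p ∈ Set.Icc (0 : ℝ) 1) (hq : q ∈ Set.Icc (0 : ℝ) 1)
    (he : e = 1 ∨ e = -1) {B : ℝ} {T : ℕ}
    (h₁ : ∀ x : ℕ → Fin 2, max 0 (e * excess q x T) -
      e * ∑ t ∈ Finset.range T, (response f (t + 1) x : ℝ) * (((x (t + 1) : ℕ) : ℝ) - q) ≤ B)
    (h₂ : ∀ x : ℕ → Fin 2, max 0 (-e * excess p x T) -
      -e * ∑ t ∈ Finset.range T, (response g (t + 1) x : ℝ) * (((x (t + 1) : ℕ) : ℝ) - p) ≤ B)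
    (x : ℕ → Fin 2 × Fin 2) :
    min p (1 - p) * |excess q (fun s => (x s).2) T| + ∑ t ∈ Finset.range T,
      (e * ((response g (t + 1) fun s => (x s).1 : ℝ) - q) * ((((x (t + 1)).1 : ℕ) : ℝ) - p) -
      e * ((response f (t + 1) fun s => (x s).2 : ℝ) - p) * ((((x (t + 1)).2 : ℕ) : ℝ) - q))
      ≤ 2 * B := by
  have a1 := h₁ fun s => (x s).2
  have a2 := h₂ fun s => (x s).1
  set N := excess q (fun s => (x s).2) T with hN
  set M := excess p (fun s => (x s).1) T with hM
  -- Player 1's regret keeps a multiple of `|N|`, as the constant strategy `p` is interior; the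
  -- analogous term of player 2 is only needed to be nonnegative.
  have b1 : min p (1 - p) * |N| ≤ max 0 (e * N) - e * (p * N) := by
    have m1 := min_le_left p (1 - p)
    have m2 := min_le_right p (1 - p)
    have m3 : 0 ≤ min p (1 - p) := le_min hp.1 (by linarith [hp.2])
    rcases he with rfl | rfl <;> rcases le_total 0 N with hn | hn
    · rw [abs_of_nonneg hn, max_eq_right (by linarith)]; nlinarith
    · rw [abs_of_nonpos hn, max_eq_left (by linarith)]; nlinarith
    · rw [abs_of_nonneg hn, max_eq_left (by linarith)]; nlinarith
    · rw [abs_of_nonpos hn, max_eq_right (by linarith)]; nlinarith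
  have b2 : 0 ≤ max 0 (-e * M) + e * (q * M) := by
    rcases he with rfl | rfl <;> rcases le_total 0 M with hn | hn
    · rw [max_eq_left (by linarith)]; nlinarith [mul_nonneg hq.1 hn]
    · rw [max_eq_right (by linarith)]; nlinarith [hq.2]
    · rw [max_eq_right (by linarith)]; nlinarith [hq.2]
    · rw [max_eq_left (by linarith)]; nlinarith [hq.1]
  have c1 : ∑ t ∈ Finset.range T, (e * ((response g (t + 1) fun s => (x s).1 : ℝ) - q) *
        ((((x (t + 1)).1 : ℕ) : ℝ) - p) -
      e * ((response f (t + 1) fun s => (x s).2 : ℝ) - p) * ((((x (t + 1)).2 : ℕ) : ℝ) - q)) =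
      e * ∑ t ∈ Finset.range T, (response g (t + 1) fun s => (x s).1 : ℝ) *
        ((((x (t + 1)).1 : ℕ) : ℝ) - p) - e * (q * M) -
      (e * ∑ t ∈ Finset.range T, (response f (t + 1) fun s => (x s).2 : ℝ) *
        ((((x (t + 1)).2 : ℕ) : ℝ) - q) - e * (p * N)) := by
    rw [hM, hN, excess, excess]
    simp only [Finset.mul_sum, ← Finset.sum_sub_distrib]
    exact Finset.sum_congr rfl fun t _ => by ring
  rw [c1]
  linarith

/-- Regret bounds averaged over the tilted play. -/
lemma tilted_regret_bound {p q e : ℝ} (hp : p ∈ Set.Icc (0 : ℝ) 1) (hq : q ∈ Set.Icc (0 : ℝ) 1)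
    (he : e = 1 ∨ e = -1) {B : ℝ} {T : ℕ}
    (h₁ : ∀ x : ℕ → Fin 2, max 0 (e * excess q x T) -
      e * ∑ t ∈ Finset.range T, (response f (t + 1) x : ℝ) * (((x (t + 1) : ℕ) : ℝ) - q) ≤ B)
    (h₂ : ∀ x : ℕ → Fin 2, max 0 (-e * excess p x T) -
      -e * ∑ t ∈ Finset.range T, (response g (t + 1) x : ℝ) * (((x (t + 1) : ℕ) : ℝ) - p) ≤ B)
    {l : ℝ} (hl : |l| ≤ 1) (x : ℕ → Fin 2 × Fin 2) :
    pathExp (fun t x a => playKernel f g t x a * tiltRatio f g q (e * l) t x a) 0 T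
      (fun y => min p (1 - p) * |excess q (fun s => (y s).2) T| +
        l * ∑ t ∈ Finset.range T, (response f (t + 1) fun s => (y s).2 : ℝ) *
          (1 - (response f (t + 1) fun s => (y s).2 : ℝ)) *
          ((response g (t + 1) fun s => (y s).1 : ℝ) - q) ^ 2) x ≤ 2 * B := by
  have hel : |e * l| ≤ 1 := by rcases he with rfl | rfl <;> simpa using hl
  have hee : e * e = 1 := by rcases he with rfl | rfl <;> norm_num
  have hk := isTransition_tilt (f := f) (g := g) hq hel
  have key := pathExp_mono hk 0 T (regret_sum_bound hp hq he h₁ h₂) x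
  rw [pathExp_const hk] at key
  refine le_trans (le_of_eq ?_) key
  rw [pathExp_add, pathExp_add, pathExp_const_mul _ _ l, pathExp_sum, pathExp_sum, Finset.mul_sum]
  congr 1
  refine Finset.sum_congr rfl fun t ht => ?_
  have ht := Finset.mem_range.1 ht
  -- Outcomes become conditional means: under the tilt, player 1's is `P + e l (Q - q) P (1 - P)`
  -- and player 2's is still `Q`. The products `(Q - q) (P - p)` cancel, and `e * e = 1` leaves the
  -- gain.
  rw [pathExp_sub,
    pathExp_mul_outcome hk 0 T t (by omega) (by omega) (fun y y' h => by
      simp only [response_fst_congr g h]) (fun a => ((a.1 : ℕ) : ℝ) - p),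
    pathExp_mul_outcome hk 0 T t (by omega) (by omega) (fun y y' h => by
      simp only [response_snd_congr f h]) (fun a => ((a.2 : ℕ) : ℝ) - q),
    ← pathExp_sub, ← pathExp_const_mul]
  refine congrFun (congrArg _ (funext fun y => ?_)) x
  simp only [playKernel, tiltRatio, Fintype.sum_prod_type, Fin.sum_univ_two, actionProb]
  norm_num
  linear_combination (-(l * (response f (t + 1) fun s => (y s).2 : ℝ) *
          (1 - (response f (t + 1) fun s => (y s).2 : ℝ)) *
          ((response g (t + 1) fun s => (y s).1 : ℝ) - q) ^ 2)) * hee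

end tilt

/-! ### Mean and variance of player 2's strategies -/

section
variable {f g : MeanBasedStrategy}

lemma pathExp_outcome_snd (q : ℝ) {t T : ℕ} (ht : t < T) (x : ℕ → Fin 2 × Fin 2) :
    pathExp (playKernel f g) 0 T (fun y => (((y (t + 1)).2 : ℕ) : ℝ) - q) x =
      pathExp (playKernel f g) 0 t (fun y => (response g (t + 1) fun s => (y s).1 : ℝ)) x - q := by
  have hk := isTransition_playKernel f g
  have h1 := pathExp_mul_outcome hk 0 T t (by omega) (by omega) (F := fun _ => 1)
    (fun _ _ _ => rfl) (fun a => ((a.2 : ℕ) : ℝ) - q) x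
  simp only [one_mul] at h1
  rw [h1]
  have h2 : (fun y => ∑ a, playKernel f g (t + 1) y a * (((a.2 : ℕ) : ℝ) - q)) =
      fun y => (response g (t + 1) fun s => (y s).1 : ℝ) - q := by
    ext y
    simp only [playKernel, Fintype.sum_prod_type, Fin.sum_univ_two, actionProb]
    norm_num
    ring
  rw [h2, pathExp_of_dependsOn hk (s := t) (m := t) (fun y y' h => by
    simp only [response_fst_congr g h]) (by omega) (by omega), pathExp_sub, pathExp_const hk]

/-- The expected empirical average of player 2 is within `O(1 / √T)` of the equilibrium. -/
lemma abs_sum_mean_sub_le {p q e : ℝ} (hp : p ∈ Set.Ioo (0 : ℝ) 1) (hq : q ∈ Set.Icc (0 : ℝ) 1)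
    (he : e = 1 ∨ e = -1) {B : ℝ} {T : ℕ}
    (h₁ : ∀ x : ℕ → Fin 2, max 0 (e * excess q x T) -
      e * ∑ t ∈ Finset.range T, (response f (t + 1) x : ℝ) * (((x (t + 1) : ℕ) : ℝ) - q) ≤ B)
    (h₂ : ∀ x : ℕ → Fin 2, max 0 (-e * excess p x T) -
      -e * ∑ t ∈ Finset.range T, (response g (t + 1) x : ℝ) * (((x (t + 1) : ℕ) : ℝ) - p) ≤ B)
    (x : ℕ → Fin 2 × Fin 2) :
    |∑ t ∈ Finset.range T, (pathExp (playKernel f g) 0 t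
      (fun y => (response g (t + 1) fun s => (y s).1 : ℝ)) x - q)| ≤ 2 * B / min p (1 - p) := by
  have hk := isTransition_playKernel f g
  -- With `l = 0` there is no tilt and no gain term, so the bound controls the mean of `|excess|`.
  have h := tilted_regret_bound (Set.Ioo_subset_Icc_self hp) hq he h₁ h₂ (l := 0) (by simp) x
  have hk0 : (fun t x a => playKernel f g t x a * tiltRatio f g q (e * 0) t x a) =
      playKernel f g := by
    ext t x a; simp [tiltRatio]
  simp only [hk0, zero_mul, add_zero] at h
  rw [pathExp_const_mul] at h
  have hm : 0 < min p (1 - p) := lt_min hp.1 (by linarith [hp.2])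
  rw [le_div_iff₀ hm, mul_comm]
  refine le_trans (mul_le_mul_of_nonneg_left ?_ hm.le) h
  refine le_trans (le_of_eq ?_) (abs_pathExp_le hk 0 T _ x)
  congr 1
  unfold excess
  rw [pathExp_sum]
  exact Finset.sum_congr rfl fun t ht => (pathExp_outcome_snd q (Finset.mem_range.1 ht) x).symm

/-- A pure action `a` is at distance at least `min q (1 - q)` from `q`; replacing `P` by `p` and `Q`
by `a` in the product costs at most `|P - p| + 2 |Q - a|`. -/
lemma variance_mul_sq_ge {p q P Q a : ℝ} (hp : p ∈ Set.Icc (0 : ℝ) 1) (hq : q ∈ Set.Icc (0 : ℝ) 1)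
    (hP : P ∈ Set.Icc (0 : ℝ) 1) (hQ : Q ∈ Set.Icc (0 : ℝ) 1) (ha : a = 0 ∨ a = 1) :
    p * (1 - p) * min q (1 - q) ^ 2 - (|P - p| + 2 * |Q - a|) ≤ P * (1 - P) * (Q - q) ^ 2 := by
  have ha1 : a ∈ Set.Icc (0 : ℝ) 1 := by rcases ha with rfl | rfl <;> norm_num
  obtain ⟨hp0, hp1⟩ := hp
  obtain ⟨hq0, hq1⟩ := hq
  obtain ⟨hP0, hP1⟩ := hP
  obtain ⟨hQ0, hQ1⟩ := hQ
  obtain ⟨ha0, ha1⟩ := ha1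
  have hm0 : 0 ≤ min q (1 - q) := le_min hq0 (by linarith)
  have h1 : min q (1 - q) ^ 2 ≤ (a - q) ^ 2 := by
    rcases ha with rfl | rfl
    · rw [zero_sub, neg_sq]; exact pow_le_pow_left₀ hm0 (min_le_left _ _) 2
    · exact pow_le_pow_left₀ hm0 (min_le_right _ _) 2
  have h2 : |P * (1 - P) - p * (1 - p)| ≤ |P - p| := by
    rw [show P * (1 - P) - p * (1 - p) = (P - p) * (1 - P - p) by ring, abs_mul]
    exact mul_le_of_le_one_right (abs_nonneg _) (abs_le.2 ⟨by linarith, by linarith⟩)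
  have h3 : |(Q - q) ^ 2 - (a - q) ^ 2| ≤ 2 * |Q - a| := by
    rw [show (Q - q) ^ 2 - (a - q) ^ 2 = (Q - a) * (Q + a - 2 * q) by ring, abs_mul, mul_comm]
    exact mul_le_mul_of_nonneg_right (abs_le.2 ⟨by linarith, by linarith⟩) (abs_nonneg _)
  have hX : 0 ≤ P * (1 - P) := mul_nonneg hP0 (by linarith)
  have hX1 : P * (1 - P) ≤ 1 := by nlinarith
  have hv : 0 ≤ p * (1 - p) := mul_nonneg hp0 (by linarith)
  have hw1 : (a - q) ^ 2 ≤ 1 := by nlinarith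
  have h4 : |P * (1 - P) * ((Q - q) ^ 2 - (a - q) ^ 2)| ≤ 2 * |Q - a| := by
    rw [abs_mul, abs_of_nonneg hX]
    exact (mul_le_of_le_one_left (abs_nonneg _) hX1).trans h3
  have h5 : |(a - q) ^ 2 * (P * (1 - P) - p * (1 - p))| ≤ |P - p| := by
    rw [abs_mul, abs_of_nonneg (sq_nonneg (a - q))]
    exact (mul_le_of_le_one_left (abs_nonneg _) hw1).trans h2
  have h6 := mul_le_mul_of_nonneg_left h1 hv
  nlinarith [(abs_le.1 h4).1, (abs_le.1 h5).1]

/-- If the mixed strategies of player 1 converge, then the actions of player 2 cannot be almost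
deterministic. -/
lemma exists_variance_lower_bound {p q e : ℝ} (hp : p ∈ Set.Ioo (0 : ℝ) 1)
    (hq : q ∈ Set.Ioo (0 : ℝ) 1) (he : e = 1 ∨ e = -1) {C : ℝ} {T₀ : ℕ}
    (h₁ : ∀ T, T₀ ≤ T → ∀ x : ℕ → Fin 2, max 0 (e * excess q x T) -
      e * ∑ t ∈ Finset.range T, (response f (t + 1) x : ℝ) * (((x (t + 1) : ℕ) : ℝ) - q) ≤ C * √T)
    (h₂ : ∀ T, T₀ ≤ T → ∀ x : ℕ → Fin 2, max 0 (-e * excess p x T) -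
      -e * ∑ t ∈ Finset.range T, (response g (t + 1) x : ℝ) * (((x (t + 1) : ℕ) : ℝ) - p) ≤ C * √T)
    (x : ℕ → Fin 2 × Fin 2)
    (hconv : Tendsto (fun t => pathExp (playKernel f g) 0 t
      (fun y => |(response f (t + 1) fun s => (y s).2 : ℝ) - p|) x) atTop (nhds 0)) :
    ∃ κ : ℝ, 0 < κ ∧ ∃ T₁ : ℕ, ∀ T, T₁ ≤ T → κ * T ≤ ∑ t ∈ Finset.range T,
      pathExp (playKernel f g) 0 t (fun y => (response g (t + 1) fun s => (y s).1 : ℝ)) x *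
      (1 - pathExp (playKernel f g) 0 t
        (fun y => (response g (t + 1) fun s => (y s).1 : ℝ)) x) := by
  have hk := isTransition_playKernel f g
  have hp' := Set.Ioo_subset_Icc_self hp
  have hq' := Set.Ioo_subset_Icc_self hq
  set b : ℕ → ℝ := fun t => pathExp (playKernel f g) 0 t
    (fun y => (response g (t + 1) fun s => (y s).1 : ℝ)) x with hb
  set α : ℕ → ℝ := fun t => pathExp (playKernel f g) 0 t
      (fun y => |(response f (t + 1) fun s => (y s).2 : ℝ) - p|) x with hα
  set η := p * (1 - p) * min q (1 - q) ^ 2 with hη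
  have hm : 0 < min q (1 - q) := lt_min hq.1 (by linarith [hq.2])
  have hη0 : 0 < η := mul_pos (mul_pos hp.1 (by linarith [hp.2])) (pow_pos hm 2)
  -- The tilt will be `γ / √T`, with a potential gain of `γ η √T`; this choice makes the regret
  -- bound `2 C √T` at most a quarter of it.
  set γ := 8 * max C 1 / η with hγ
  have hC1 : 0 < max C 1 := lt_max_of_lt_right one_pos
  have hγ0 : 0 < γ := by positivity
  have hCγ : 2 * C ≤ η / 4 * γ := by
    have : η / 4 * γ = 2 * max C 1 := by rw [hγ]; field_simp; norm_num
    rw [this]; linarith [le_max_left C 1]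
  -- Weight in the inequality `Λ A ≤ (ε / 2) Λ ^ 2 + (3 / (2 ε)) A` below. As the likelihood ratio
  -- has second moment at most `exp (γ ^ 2)`, the first term costs at most another quarter of `η`
  -- per round.
  set ε := η / 2 * Real.exp (-γ ^ 2) with hε
  have hε0 : 0 < ε := by positivity
  have hεγ : ε / 2 * Real.exp (γ ^ 2) = η / 4 := by
    rw [hε, show η / 2 * Real.exp (-γ ^ 2) / 2 * Real.exp (γ ^ 2) =
      η / 4 * (Real.exp (-γ ^ 2) * Real.exp (γ ^ 2)) by ring, ← Real.exp_add]
    simp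
  have hb0 : ∀ t, 0 ≤ b t := fun t => pathExp_nonneg hk 0 t
    (fun y => (response g (t + 1) fun s => (y s).1).2.1) x
  have hb1 : ∀ t, b t ≤ 1 := fun t => by
    have := pathExp_mono hk 0 t
      (fun y => (response g (t + 1) fun s => (y s).1).2.2) x
    rwa [pathExp_const hk] at this
  -- The pure action nearest to the mean `b t`; the mean of `|Q - a t|` is then `min (b t) (1 - b t)
  -- ≤ 2 b t (1 - b t)`.
  let a : ℕ → ℝ := fun t => if 1 / 2 ≤ b t then 1 else 0
  have ha : ∀ t, a t = 0 ∨ a t = 1 := fun t => by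
    by_cases h : 1 / 2 ≤ b t
    · exact Or.inr (if_pos h)
    · exact Or.inl (if_neg h)
  let A : ℕ → (ℕ → Fin 2 × Fin 2) → ℝ := fun t y =>
    |(response f (t + 1) fun s => (y s).2 : ℝ) - p| +
      2 * |(response g (t + 1) fun s => (y s).1 : ℝ) - a t|
  have hA0 : ∀ t y, 0 ≤ A t y := fun t y => by positivity
  have hA3 : ∀ t y, A t y ≤ 3 := fun t y => by
    have hP := (response f (t + 1) fun s => (y s).2).2
    have hQ := (response g (t + 1) fun s => (y s).1).2
    have h1 : |(response f (t + 1) fun s => (y s).2 : ℝ) - p| ≤ 1 :=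
      abs_le.2 ⟨by linarith [hP.1, hp.2], by linarith [hP.2, hp.1]⟩
    have h2 : |(response g (t + 1) fun s => (y s).1 : ℝ) - a t| ≤ 1 := by
      rcases ha t with h | h <;> rw [h] <;>
        exact abs_le.2 ⟨by linarith [hQ.1], by linarith [hQ.2]⟩
    simp only [A]; linarith
  have hEA : ∀ t T, t < T → pathExp (playKernel f g) 0 T (A t) x ≤
      α t + 4 * (b t * (1 - b t)) := by
    intro t T htT
    have hdep : DependsOn (A t) (Set.Icc 1 t) := fun y y' h => by
      simp only [A, response_snd_congr f h, response_fst_congr g h]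
    rw [pathExp_of_dependsOn hk hdep (m := t) (by omega) htT.le]
    simp only [A]
    rw [pathExp_add, pathExp_const_mul]
    have : pathExp (playKernel f g) 0 t
        (fun y => |(response g (t + 1) fun s => (y s).1 : ℝ) - a t|) x ≤ 2 * (b t * (1 - b t)) := by
      by_cases h : 1 / 2 ≤ b t
      · have h1 : (fun y : ℕ → Fin 2 × Fin 2 =>
            |(response g (t + 1) fun s => (y s).1 : ℝ) - a t|) =
            fun y => 1 - (response g (t + 1) fun s => (y s).1 : ℝ) := by
          ext y
          simp only [a, if_pos h]
          rw [abs_of_nonpos (by linarith [(response g (t + 1) fun s => (y s).1).2.2])]; ring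
        rw [h1, pathExp_sub, pathExp_const hk]
        change 1 - b t ≤ _
        nlinarith [hb1 t]
      · have h1 : (fun y : ℕ → Fin 2 × Fin 2 =>
            |(response g (t + 1) fun s => (y s).1 : ℝ) - a t|) =
            fun y => (response g (t + 1) fun s => (y s).1 : ℝ) := by
          ext y
          simp only [a, if_neg h, sub_zero]
          rw [abs_of_nonneg (response g (t + 1) fun s => (y s).1).2.1]
        rw [h1]
        change b t ≤ _
        push Not at h
        nlinarith [hb0 t]
    change α t + _ ≤ _
    linarith
  obtain ⟨T₂, hT₂⟩ : ∃ T₂ : ℕ, ∀ T, T₂ ≤ T →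
      ∑ t ∈ Finset.range T, α t ≤ η * ε / 6 * T := by
    have h := (hconv.cesaro).eventually_le_const (show (0 : ℝ) < η * ε / 6 by positivity)
    obtain ⟨T₂, hT₂⟩ := eventually_atTop.1 h
    refine ⟨T₂ + 1, fun T hT => ?_⟩
    have h := hT₂ T (by omega)
    have hTpos : (0 : ℝ) < T := by exact_mod_cast (show 0 < T by omega)
    rwa [inv_mul_le_iff₀ hTpos, mul_comm] at h
  refine ⟨η * ε / 24, by positivity, max (max T₀ T₂) (⌈γ ^ 2⌉₊ + 1), fun T hT => ?_⟩
  have hT0 : T₀ ≤ T := (le_max_left _ _).trans ((le_max_left _ _).trans hT)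
  have hT2 : T₂ ≤ T := (le_max_right _ _).trans ((le_max_left _ _).trans hT)
  have hT3 : ⌈γ ^ 2⌉₊ + 1 ≤ T := (le_max_right _ _).trans hT
  have hTpos : (0 : ℝ) < T := by exact_mod_cast (show 0 < T by omega)
  have hs0 : 0 < √(T : ℝ) := Real.sqrt_pos.2 hTpos
  have hss : √(T : ℝ) * √T = T := Real.mul_self_sqrt hTpos.le
  have hγT : γ ≤ √T := by
    refine Real.le_sqrt_of_sq_le ((Nat.le_ceil _).trans ?_)
    exact_mod_cast (Nat.le_succ _).trans hT3
  set l := γ / √T with hl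
  have hl0 : 0 < l := by positivity
  have hl1 : |l| ≤ 1 := by rw [abs_of_pos hl0]; exact (div_le_one hs0).2 hγT
  have hel : |e * l| ≤ 1 := by rcases he with rfl | rfl <;> simpa using hl1
  have hk' := isTransition_tilt (f := f) (g := g) hq' hel
  have key := tilted_regret_bound hp' hq' he (h₁ T hT0) (h₂ T hT0) hl1 x
  -- The nonnegative excess term is dropped and the gain is bounded below by `η` per round minus the
  -- errors `A t`.
  have key2 := (pathExp_mono hk' 0 T (F := fun y => l * (T * η - ∑ t ∈ Finset.range T, A t y))
    (fun y => ?_) x).trans key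
  swap
  · have hN : 0 ≤ min p (1 - p) * |excess q (fun s => (y s).2) T| :=
      mul_nonneg (le_min hp.1.le (by linarith [hp.2])) (abs_nonneg _)
    refine le_trans (mul_le_mul_of_nonneg_left ?_ hl0.le) (le_add_of_nonneg_left hN)
    have : (T : ℝ) * η = ∑ t ∈ Finset.range T, η := by simp
    rw [this, ← Finset.sum_sub_distrib]
    exact Finset.sum_le_sum fun t _ => variance_mul_sq_ge hp' hq' (Subtype.prop _)
      (Subtype.prop _) (ha t)
  rw [pathExp_const_mul, pathExp_sub, pathExp_const hk',
    pathExp_tilt (fun t a => tiltRatio_dependsOn q (e * l) t a)] at key2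
  -- The errors under the tilted law are estimated by their means under the original play, using
  -- AM-GM and `A t ≤ 3`.
  have hL : pathExp (playKernel f g) 0 T
      (fun y => likelihood (tiltRatio f g q (e * l)) T y * ∑ t ∈ Finset.range T, A t y) x ≤
      T * (η / 4) + 3 / (2 * ε) * ∑ t ∈ Finset.range T, (α t + 4 * (b t * (1 - b t))) := by
    have h1 := pathExp_mono hk 0 T (F := fun y => likelihood (tiltRatio f g q (e * l)) T y *
      ∑ t ∈ Finset.range T, A t y) (F' := fun y => T * (ε / 2) *
        likelihood (tiltRatio f g q (e * l)) T y ^ 2 + 3 / (2 * ε) * ∑ t ∈ Finset.range T, A t y)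
      (fun y => by
        set Λ := likelihood (tiltRatio f g q (e * l)) T y
        have : (T : ℝ) * (ε / 2) * Λ ^ 2 = ∑ t ∈ Finset.range T, ε / 2 * Λ ^ 2 := by
          simp; ring
        rw [this, Finset.mul_sum, Finset.mul_sum, ← Finset.sum_add_distrib]
        refine Finset.sum_le_sum fun t _ => ?_
        have h3 := mul_le_mul_of_nonneg_left (hA3 t y) (hA0 t y)
        rw [show ε / 2 * Λ ^ 2 + 3 / (2 * ε) * A t y = ((ε * Λ) ^ 2 + A t y * 3) / (2 * ε) by
          field_simp, le_div_iff₀ (by positivity)]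
        nlinarith [sq_nonneg (ε * Λ - A t y)]) x
    refine h1.trans ?_
    rw [pathExp_add, pathExp_const_mul, pathExp_const_mul, pathExp_sum]
    have h4 : pathExp (playKernel f g) 0 T
        (fun y => likelihood (tiltRatio f g q (e * l)) T y ^ 2) x ≤ Real.exp (γ ^ 2) := by
      refine (pathExp_likelihood_sq_le hk (fun t a => tiltRatio_dependsOn q (e * l) t a)
        (by positivity) (fun t y => sum_playKernel_tiltRatio_sq_le hq' (t + 1) y) T x).trans ?_
      have h5 : (e * l) ^ 2 = γ ^ 2 / T := by
        have : e ^ 2 = 1 := by rcases he with rfl | rfl <;> norm_num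
        rw [mul_pow, this, one_mul, hl, div_pow, Real.sq_sqrt hTpos.le]
      rw [h5]
      calc (1 + γ ^ 2 / T) ^ T ≤ Real.exp (γ ^ 2 / T) ^ T :=
            pow_le_pow_left₀ (by positivity)
              (by linarith [Real.add_one_le_exp (γ ^ 2 / (T : ℝ))]) T
        _ = Real.exp (γ ^ 2) := by
            rw [← Real.exp_nat_mul]; congr 1; field_simp
    refine add_le_add ?_ (mul_le_mul_of_nonneg_left (Finset.sum_le_sum fun t ht =>
      hEA t T (Finset.mem_range.1 ht)) (by positivity))
    rw [← hεγ, mul_assoc]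
    exact mul_le_mul_of_nonneg_left (mul_le_mul_of_nonneg_left h4 (by positivity)) hTpos.le
  rw [Finset.sum_add_distrib, ← Finset.mul_sum] at hL
  set V := ∑ t ∈ Finset.range T, b t * (1 - b t)
  have hS := hT₂ T hT2
  set S := ∑ t ∈ Finset.range T, α t
  have h6 : l * (T * η - (T * (η / 4) + 3 / (2 * ε) * (S + 4 * V))) ≤ 2 * (C * √T) :=
    le_trans (mul_le_mul_of_nonneg_left (by linarith) hl0.le) key2
  have h7 : γ * (T * η - (T * (η / 4) + 3 / (2 * ε) * (S + 4 * V))) ≤ η / 4 * γ * T := by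
    have h8 := mul_le_mul_of_nonneg_right h6 hs0.le
    have h9 : l * √T = γ := by rw [hl]; field_simp
    rw [mul_right_comm, h9, show 2 * (C * √T) * √T = 2 * C * (√T * √T) by ring, hss] at h8
    exact h8.trans (mul_le_mul_of_nonneg_right hCγ hTpos.le)
  have h10 : T * η - (T * (η / 4) + 3 / (2 * ε) * (S + 4 * V)) ≤ η / 4 * T := by
    refine le_of_mul_le_mul_left ?_ hγ0
    linarith
  -- Half of `η T` must be made up by the errors; the convergence term `S` can account for only half
  -- of that, so `V` carries the rest.
  have h11 : η / 2 * T ≤ 3 / (2 * ε) * (S + 4 * V) := by linarith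
  rw [div_mul_eq_mul_div 3, le_div_iff₀ (by positivity)] at h11
  nlinarith

end

/-! ### Counts, and independent opponents with a drift -/

/-- The number of times that action `1` is played in the rounds `1, …, t`. -/
def countOne (x : ℕ → Fin 2) (t : ℕ) : ℕ := ∑ s ∈ Finset.range t, (x (s + 1) : ℕ)

/-- The frequency of an action that has been played `z` times in `t` rounds. -/
def freq (t z : ℕ) : unitInterval := Set.projIcc (0 : ℝ) 1 zero_le_one ((z : ℝ) / t)

lemma countOne_succ (x : ℕ → Fin 2) (t : ℕ) :
    countOne x (t + 1) = countOne x t + (x (t + 1) : ℕ) := Finset.sum_range_succ _ _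

lemma countOne_le (x : ℕ → Fin 2) (t : ℕ) : countOne x t ≤ t := by
  induction t with
  | zero => simp [countOne]
  | succ t ih => rw [countOne_succ]; omega

lemma countOne_update (x : ℕ → Fin 2) {s t : ℕ} (h : s < t) (a : Fin 2) :
    countOne (Function.update x t a) s = countOne x s :=
  Finset.sum_congr rfl fun i hi => by
    rw [Function.update_of_ne (by have := Finset.mem_range.1 hi; omega)]

lemma empAvg_coe (x : ℕ → Fin 2) (t : ℕ) : (empAvg x t : ℝ) = (countOne x t : ℝ) / t := by
  simp only [empAvg, sum_Icc_one_eq_sum_range, countOne, Nat.cast_sum]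

lemma empAvg_eq_freq (x : ℕ → Fin 2) (t : ℕ) : empAvg x t = freq t (countOne x t) := by
  rw [freq, ← empAvg_coe, Set.projIcc_val]

lemma response_succ (f : MeanBasedStrategy) (x : ℕ → Fin 2) (t : ℕ) :
    response f (t + 1) x = f (t + 1) (freq t (countOne x t)) := by
  rw [response, Nat.add_sub_cancel, empAvg_eq_freq]

lemma excess_eq (q : ℝ) (x : ℕ → Fin 2) (t : ℕ) : excess q x t = countOne x t - t * q := by
  simp [excess, countOne, Finset.sum_sub_distrib]

lemma excess_succ (q : ℝ) (x : ℕ → Fin 2) (t : ℕ) :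
    excess q x (t + 1) = excess q x t + (((x (t + 1) : ℕ) : ℝ) - q) := Finset.sum_range_succ _ _

/-- The kernel of independent Bernoulli variables with success probability `r`. -/
def iidKernel (r : ℝ) (_ : ℕ) (_ : ℕ → Fin 2) (a : Fin 2) : ℝ := if a = 1 then r else 1 - r

lemma isTransition_iidKernel {r : ℝ} (hr : r ∈ Set.Icc (0 : ℝ) 1) :
    IsTransition (iidKernel r) where
  nonneg t x a := by
    unfold iidKernel; split_ifs
    · exact hr.1
    · linarith [hr.2]
  sum_eq_one t x := by simp [iidKernel]
  past t a := fun x y _ => rfl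

lemma stepExp_iidKernel (r : ℝ) (t : ℕ) (F : (ℕ → Fin 2) → ℝ) (x : ℕ → Fin 2) :
    stepExp (iidKernel r) t F x =
      (1 - r) * F (Function.update x t 0) + r * F (Function.update x t 1) := by
  simp [stepExp_apply, iidKernel]

/-- The initial sequence that plays action `1` in the rounds `1, …, u` and action `0` later. -/
def initialOnes (u s : ℕ) : Fin 2 := if s ≤ u then 1 else 0

lemma countOne_initialOnes {u t : ℕ} (h : u ≤ t) : countOne (initialOnes u) t = u := by
  induction t, h using Nat.le_induction with
  | base =>
    rw [countOne, Finset.sum_congr rfl (g := fun _ => 1)]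
    · simp
    · intro s hs
      have := Finset.mem_range.1 hs
      simp [initialOnes, show s + 1 ≤ u by omega]
  | succ t h ih => rw [countOne_succ, ih]; simp [initialOnes, show ¬ t + 1 ≤ u by omega]

/-- Starting from uniformly distributed counts, the count never charges a point with more than the
initial mass of a point. -/
lemma sum_pathExp_countOne_le {r : ℝ} (hr : r ∈ Set.Icc (0 : ℝ) 1) (L m : ℕ) {φ : ℕ → ℝ} {W : ℝ}
    (hφ : ∀ A : Finset ℕ, ∑ z ∈ A, φ z ≤ W) :
    ∑ u ∈ Finset.range (L + 1),
      pathExp (iidKernel r) L m (fun y => φ (countOne y (L + m))) (initialOnes u) ≤ W := by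
  induction m generalizing φ with
  | zero =>
    refine le_trans (le_of_eq ?_) (hφ (Finset.range (L + 1)))
    refine Finset.sum_congr rfl fun u hu => ?_
    have := Finset.mem_range.1 hu
    rw [pathExp_zero, add_zero, countOne_initialOnes (by omega)]
  | succ m ih =>
    have h1 : stepExp (iidKernel r) (L + m + 1) (fun y => φ (countOne y (L + (m + 1)))) =
        fun y => (1 - r) * φ (countOne y (L + m)) + r * φ (countOne y (L + m) + 1) := by
      ext y
      rw [stepExp_iidKernel, ← add_assoc, countOne_succ, countOne_succ,
        countOne_update _ (Nat.lt_succ_self _), countOne_update _ (Nat.lt_succ_self _)]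
      simp
    simp only [pathExp_succ, h1]
    -- One round replaces `φ` by a convex combination of `φ` and its shift, which preserves the
    -- bound on all finite sums; hence the induction over general `φ`.
    refine ih (φ := fun z => (1 - r) * φ z + r * φ (z + 1)) fun A => ?_
    rw [Finset.sum_add_distrib, ← Finset.mul_sum, ← Finset.mul_sum]
    have h2 := hφ (A.map (addRightEmbedding 1))
    rw [Finset.sum_map] at h2
    simp only [addRightEmbedding_apply] at h2
    nlinarith [hφ A, hr.1, hr.2]

/-- One round adds `2 d X` plus at most `1` to the mean of `X ^ 2`, and `2 d X ≤ d ^ 2 X ^ 2 + 1`.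
For `d` of order `1 / √T` the growth factor stays bounded over `T` rounds. -/
lemma pathExp_excess_sq_le {q d : ℝ} (hq : q ∈ Set.Icc (0 : ℝ) 1)
    (hr : q + d ∈ Set.Icc (0 : ℝ) 1) (L m : ℕ) (x : ℕ → Fin 2) :
    pathExp (iidKernel (q + d)) L m (fun y => excess q y (L + m) ^ 2) x ≤
      (1 + d ^ 2) ^ m * (excess q x L ^ 2 + 2 * m) := by
  induction m with
  | zero => simp
  | succ m ih =>
    have hk := isTransition_iidKernel hr
    have h1 : ∀ y, stepExp (iidKernel (q + d)) (L + m + 1)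
        (fun y => excess q y (L + (m + 1)) ^ 2) y ≤
        (1 + d ^ 2) * excess q y (L + m) ^ 2 + 2 := by
      intro y
      rw [stepExp_iidKernel, ← add_assoc, excess_succ, excess_succ, excess_eq q _ (L + m),
        excess_eq q (Function.update y (L + m + 1) 1) (L + m),
        countOne_update _ (Nat.lt_succ_self _), countOne_update _ (Nat.lt_succ_self _),
        ← excess_eq]
      simp only [Function.update_self]
      set X := excess q y (L + m)
      norm_num
      have h2 : (1 - (q + d)) * q ^ 2 + (q + d) * (1 - q) ^ 2 ≤ 1 := by
        have a1 : q ^ 2 ≤ 1 := by nlinarith [hq.1, hq.2]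
        have a2 : (1 - q) ^ 2 ≤ 1 := by nlinarith [hq.1, hq.2]
        nlinarith [hr.1, hr.2]
      nlinarith [sq_nonneg (d * X - 1)]
    rw [pathExp_succ]
    refine (pathExp_mono hk L m h1 x).trans ?_
    rw [pathExp_add, pathExp_const_mul, pathExp_const hk]
    have h3 : (1 : ℝ) ≤ (1 + d ^ 2) ^ (m + 1) :=
      one_le_pow₀ (by nlinarith [sq_nonneg d])
    have h4 := mul_le_mul_of_nonneg_left ih (show 0 ≤ 1 + d ^ 2 by positivity)
    push_cast
    rw [pow_succ' (1 + d ^ 2) m] at h3 ⊢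
    linarith

lemma response_dependsOn (f : MeanBasedStrategy) (t : ℕ) :
    DependsOn (fun y : ℕ → Fin 2 => (response f (t + 1) y : ℝ)) (Set.Icc 1 t) := by
  intro y y' h
  simp only [response, Nat.add_sub_cancel, empAvg_congr h]

lemma abs_coe_sub_le_one (P : unitInterval) {p : ℝ} (hp : p ∈ Set.Icc (0 : ℝ) 1) :
    |(P : ℝ) - p| ≤ 1 :=
  abs_le.2 ⟨by linarith [P.2.1, hp.2], by linarith [P.2.2, hp.1]⟩

/-- The maximum is bounded below by the payoff of action `1` alone, and each of the first `L` rounds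
contributes at least `-1`. -/
lemma sum_later_rounds_le {f : MeanBasedStrategy} {q e B : ℝ} (hq : q ∈ Set.Icc (0 : ℝ) 1)
    (he : e = 1 ∨ e = -1) {L m : ℕ} {y : ℕ → Fin 2}
    (h : max 0 (e * excess q y (L + m)) - e * ∑ t ∈ Finset.range (L + m),
      (response f (t + 1) y : ℝ) * (((y (t + 1) : ℕ) : ℝ) - q) ≤ B) :
    ∑ i ∈ Finset.range m,
      (e * (1 - (response f (L + i + 1) y : ℝ))) * (((y (L + i + 1) : ℕ) : ℝ) - q) ≤ B + L := by
  have a2 : ∑ t ∈ Finset.range (L + m),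
      (e * (1 - (response f (t + 1) y : ℝ))) * (((y (t + 1) : ℕ) : ℝ) - q) ≤ B := by
    refine le_trans (le_of_eq ?_) (le_trans (sub_le_sub_right (le_max_right 0 _) _) h)
    rw [excess, Finset.mul_sum, Finset.mul_sum, ← Finset.sum_sub_distrib]
    exact Finset.sum_congr rfl fun t _ => by ring
  rw [Finset.sum_range_add] at a2
  have a3 : -(L : ℝ) ≤ ∑ t ∈ Finset.range L,
      (e * (1 - (response f (t + 1) y : ℝ))) * (((y (t + 1) : ℕ) : ℝ) - q) := by
    have : -(L : ℝ) = ∑ t ∈ Finset.range L, (-1 : ℝ) := by simp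
    rw [this]
    refine Finset.sum_le_sum fun t _ => (abs_le.1 ?_).1
    have hP := (response f (t + 1) y).2
    have hy0 : (0 : ℝ) ≤ ((y (t + 1) : ℕ) : ℝ) := Nat.cast_nonneg _
    have hy1 : ((y (t + 1) : ℕ) : ℝ) ≤ 1 := by
      exact_mod_cast (show (y (t + 1) : ℕ) ≤ 1 by omega)
    rw [abs_mul, abs_mul]
    refine mul_le_one₀ (mul_le_one₀ ?_ (abs_nonneg _) ?_) (abs_nonneg _) ?_
    · rcases he with rfl | rfl <;> simp
    · exact abs_le.2 ⟨by linarith [hP.2], by linarith [hP.1]⟩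
    · exact abs_le.2 ⟨by linarith [hq.2], by linarith [hq.1]⟩
  linarith

/-- Expected regret against an opponent who plays action `1` with probability `q + e * l`. -/
lemma drift_regret_bound {f : MeanBasedStrategy} {p q e l B : ℝ} (hq : q ∈ Set.Icc (0 : ℝ) 1)
    (he : e = 1 ∨ e = -1) (hl : 0 ≤ l) (hr : q + e * l ∈ Set.Icc (0 : ℝ) 1) {L m : ℕ}
    (h : ∀ y : ℕ → Fin 2, max 0 (e * excess q y (L + m)) - e * ∑ t ∈ Finset.range (L + m),
      (response f (t + 1) y : ℝ) * (((y (t + 1) : ℕ) : ℝ) - q) ≤ B) (x : ℕ → Fin 2) :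
    l * (m * (1 - p) - ∑ i ∈ Finset.range m, pathExp (iidKernel (q + e * l)) L i
      (fun y => |(response f (L + i + 1) y : ℝ) - p|) x) ≤ B + L := by
  have hk := isTransition_iidKernel hr
  have hee : e * e = 1 := by rcases he with rfl | rfl <;> norm_num
  have a1 := pathExp_mono hk L m (fun y => sum_later_rounds_le hq he (h y)) x
  rw [pathExp_const hk, pathExp_sum] at a1
  refine le_trans ?_ a1
  have : (m : ℝ) * (1 - p) = ∑ i ∈ Finset.range m, (1 - p) := by
    rw [Finset.sum_const, Finset.card_range, nsmul_eq_mul]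
  rw [this, ← Finset.sum_sub_distrib, Finset.mul_sum]
  refine Finset.sum_le_sum fun i hi => ?_
  have hi := Finset.mem_range.1 hi
  rw [pathExp_mul_outcome hk L m (L + i) (by omega) (by omega)
    (F := fun y => e * (1 - (response f (L + i + 1) y : ℝ)))
    (fun y y' h => by have := response_dependsOn f (L + i) h; simp only at this; simp only [this])
    (fun a => ((a : ℕ) : ℝ) - q)]
  have a2 : pathExp (iidKernel (q + e * l)) L m
      (fun y => l * ((1 - p) - |(response f (L + i + 1) y : ℝ) - p|)) x =
      l * (1 - p - pathExp (iidKernel (q + e * l)) L i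
        (fun y => |(response f (L + i + 1) y : ℝ) - p|) x) := by
    rw [pathExp_const_mul, pathExp_sub, pathExp_const hk,
      pathExp_of_dependsOn hk (s := L + i) (m := i) (fun y y' h => by
        have := response_dependsOn f (L + i) h; simp only at this; simp only [this])
        (by omega) (by omega)]
  rw [← a2]
  refine pathExp_mono hk L m (fun y => ?_) _
  simp only [iidKernel, Fin.sum_univ_two]
  norm_num
  set P := (response f (L + i + 1) y : ℝ)
  -- The opponent's outcome has mean `q + e * l`, and the signs cancel.
  have a3 : e * (1 - P) * (-((1 - (q + e * l)) * q) + (q + e * l) * (1 - q)) = l * (1 - P) := by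
    linear_combination (l * (1 - P)) * hee
  rw [a3]
  exact mul_le_mul_of_nonneg_left (by linarith [le_abs_self (P - p)]) hl

/-- If the strategy is nearly constant on a window, then it is nearly constant in expectation
against a drifting opponent with uniformly distributed initial counts. -/
lemma sum_pathExp_response_sub_le {f : MeanBasedStrategy} {p q d γ Γ W : ℝ}
    (hp : p ∈ Set.Icc (0 : ℝ) 1) (hq : q ∈ Set.Icc (0 : ℝ) 1) (hr : q + d ∈ Set.Icc (0 : ℝ) 1)
    {T L i : ℕ} (hd : d ^ 2 * T = γ ^ 2) (hL : (L : ℝ) ^ 2 ≤ 4 * T) (hi : i ≤ T) (hΓ : 0 < Γ)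
    (ht : 0 < L + i)
    (hW : ∑ z ∈ Finset.range (L + i + 1) with |((z : ℕ) : ℝ) - (L + i : ℕ) * q| ≤ Γ * √(L + i : ℕ),
      |(f (L + i + 1) (freq (L + i) z) : ℝ) - p| ≤ W) :
    ∑ u ∈ Finset.range (L + 1), pathExp (iidKernel (q + d)) L i
      (fun y => |(response f (L + i + 1) y : ℝ) - p|) (initialOnes u) ≤
      W + (L + 1) * (Real.exp (γ ^ 2) * (6 * T) / (Γ ^ 2 * (L + i : ℕ))) := by
  have hk := isTransition_iidKernel hr
  set t := L + i with ht'
  have htpos : (0 : ℝ) < t := by exact_mod_cast ht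
  -- The deviation on the window. Off the window it is at most `1`, hence at most the squared excess
  -- over `Γ ^ 2 t`, as in Chebyshev's inequality.
  let φ : ℕ → ℝ := fun z => if z ∈ (Finset.range (t + 1)).filter
    (fun z : ℕ => |(z : ℝ) - t * q| ≤ Γ * √t) then |(f (t + 1) (freq t z) : ℝ) - p| else 0
  have hφ : ∀ A : Finset ℕ, ∑ z ∈ A, φ z ≤ W := by
    intro A
    refine le_trans ?_ hW
    rw [← Finset.sum_filter]
    exact Finset.sum_le_sum_of_subset_of_nonneg
      (fun z hz => (Finset.mem_filter.1 hz).2) fun _ _ _ => abs_nonneg _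
  have hpt : ∀ y : ℕ → Fin 2, |(response f (t + 1) y : ℝ) - p| ≤
      φ (countOne y t) + 1 / (Γ ^ 2 * t) * excess q y t ^ 2 := by
    intro y
    rw [response_succ]
    by_cases h : |(countOne y t : ℝ) - t * q| ≤ Γ * √t
    · have hmem : countOne y t ∈ (Finset.range (t + 1)).filter
          (fun z : ℕ => |(z : ℝ) - t * q| ≤ Γ * √t) :=
        Finset.mem_filter.2 ⟨Finset.mem_range.2 (Nat.lt_succ_of_le (countOne_le y t)), h⟩
      simp only [φ, if_pos hmem]
      exact le_add_of_nonneg_right (by positivity)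
    · have hmem : countOne y t ∉ (Finset.range (t + 1)).filter
          (fun z : ℕ => |(z : ℝ) - t * q| ≤ Γ * √t) := fun hc => h (Finset.mem_filter.1 hc).2
      simp only [φ, if_neg hmem]
      rw [zero_add, excess_eq]
      refine (abs_coe_sub_le_one _ hp).trans ?_
      rw [one_div, ← div_eq_inv_mul, one_le_div (by positivity), ← sq_abs ((countOne y t : ℝ) - _)]
      have := pow_le_pow_left₀ (by positivity) (not_le.1 h).le 2
      rwa [mul_pow, Real.sq_sqrt htpos.le] at this
  have hsq : ∀ u ∈ Finset.range (L + 1), pathExp (iidKernel (q + d)) L i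
      (fun y => excess q y t ^ 2) (initialOnes u) ≤ Real.exp (γ ^ 2) * (6 * T) := by
    intro u hu
    have hu := Finset.mem_range.1 hu
    refine (pathExp_excess_sq_le hq hr L i (initialOnes u)).trans ?_
    refine mul_le_mul ?_ ?_ (by positivity) (by positivity)
    · calc (1 + d ^ 2) ^ i ≤ (1 + d ^ 2) ^ T :=
            pow_le_pow_right₀ (le_add_of_nonneg_right (by positivity)) hi
        _ ≤ Real.exp (d ^ 2) ^ T :=
            pow_le_pow_left₀ (by positivity) (by linarith [Real.add_one_le_exp (d ^ 2)]) T
        _ = Real.exp (γ ^ 2) := by rw [← Real.exp_nat_mul, ← hd, mul_comm]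
    · rw [excess_eq, countOne_initialOnes (by omega)]
      have hu' : (u : ℝ) ≤ L := by exact_mod_cast (show u ≤ L by omega)
      have hu0 : (0 : ℝ) ≤ u := Nat.cast_nonneg _
      have hL0 : (0 : ℝ) ≤ L := Nat.cast_nonneg _
      have b1 : |(u : ℝ) - L * q| ≤ L := abs_le.2 ⟨by nlinarith [hq.2], by nlinarith [hq.1]⟩
      have b2 : ((u : ℝ) - L * q) ^ 2 ≤ L ^ 2 := by
        rw [← sq_abs]; exact pow_le_pow_left₀ (abs_nonneg _) b1 2
      have b3 : (i : ℝ) ≤ T := by exact_mod_cast hi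
      linarith
  calc _ ≤ ∑ u ∈ Finset.range (L + 1), (pathExp (iidKernel (q + d)) L i
          (fun y => φ (countOne y t)) (initialOnes u) +
          1 / (Γ ^ 2 * t) * (Real.exp (γ ^ 2) * (6 * T))) := by
        refine Finset.sum_le_sum fun u hu => ?_
        refine (pathExp_mono hk L i hpt (initialOnes u)).trans ?_
        rw [pathExp_add, pathExp_const_mul]
        exact add_le_add le_rfl (mul_le_mul_of_nonneg_left (hsq u hu) (by positivity))
    _ ≤ _ := by
        rw [Finset.sum_add_distrib]
        refine add_le_add (sum_pathExp_countOne_le hr L i hφ) (le_of_eq ?_)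
        rw [Finset.sum_const, Finset.card_range, nsmul_eq_mul, one_div_mul_eq_div]
        push_cast
        rfl

set_option maxHeartbeats 1000000 in
/-- A mean-based strategy with regret of order `√T` cannot be nearly constant on the windows of
size `√t` around the indifference point: the regret would be large against an opponent whose
frequencies drift through such a window. -/
lemma not_flat_of_regret_bound {f : MeanBasedStrategy} {p q e : ℝ} (hp : p ∈ Set.Ioo (0 : ℝ) 1)
    (hq : q ∈ Set.Ioo (0 : ℝ) 1) (he : e = 1 ∨ e = -1) {C : ℝ} {T₀ : ℕ}
    (h₁ : ∀ T, T₀ ≤ T → ∀ x : ℕ → Fin 2, max 0 (e * excess q x T) -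
      e * ∑ t ∈ Finset.range T, (response f (t + 1) x : ℝ) * (((x (t + 1) : ℕ) : ℝ) - q) ≤ C * √T)
    (hflat : ∀ Γ : ℝ, 0 < Γ → ∀ ε : ℝ, 0 < ε → ∃ T₁ : ℕ, ∀ t, T₁ ≤ t →
      ∑ z ∈ Finset.range (t + 1) with |((z : ℕ) : ℝ) - t * q| ≤ Γ * √t,
        |(f (t + 1) (freq t z) : ℝ) - p| ≤ ε * √t) : False := by
  have hq' := Set.Ioo_subset_Icc_self hq
  have hp1 : 0 < 1 - p := by linarith [hp.2]
  have hee : e * e = 1 := by rcases he with rfl | rfl <;> norm_num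
  set C' := max C 0 + 3 with hC'
  have hC'0 : 0 < C' := by positivity
  -- With drift `γ / √T`, even half of the ideal loss `γ (1 - p) √T` is `C' √T`, and the `3` in `C'`
  -- pays for the `L` initial rounds.
  set γ := 2 * C' / (1 - p) with hγ
  have hγ0 : 0 < γ := by positivity
  have hγp : γ * (1 - p) = 2 * C' := by rw [hγ]; field_simp
  set θ := (1 - p) / 16 with hθ
  have hθ0 : 0 < θ := by positivity
  -- The window is so wide that, in rounds `t ≥ θ T`, leaving it contributes at most `θ`.
  set Γ := √(6 * Real.exp (γ ^ 2) / (θ * θ)) with hΓ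
  have hΓ0 : 0 < Γ := Real.sqrt_pos.2 (by positivity)
  have hΓ2 : Γ ^ 2 * (θ * θ) = 6 * Real.exp (γ ^ 2) := by
    rw [hΓ, Real.sq_sqrt (by positivity)]; field_simp
  obtain ⟨T₁, hT₁⟩ := hflat Γ hΓ0 θ hθ0
  obtain ⟨T, hTT₀, hTθ, hTγ, hT64⟩ : ∃ T : ℕ, T₀ ≤ T ∧ ((T₁ : ℝ) + 1 ≤ θ * T) ∧
      (γ / min q (1 - q)) ^ 2 ≤ T ∧ (64 : ℝ) ≤ T := by
    have hlim : Tendsto (fun T : ℕ => (T : ℝ)) atTop atTop := tendsto_natCast_atTop_atTop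
    have hlim' : Tendsto (fun T : ℕ => θ * (T : ℝ)) atTop atTop := hlim.const_mul_atTop hθ0
    exact ((eventually_ge_atTop T₀).and ((hlim'.eventually_ge_atTop _).and
      ((hlim.eventually_ge_atTop _).and (hlim.eventually_ge_atTop _)))).exists
  have hTpos : (0 : ℝ) < T := by linarith
  have hs0 : 0 < √(T : ℝ) := Real.sqrt_pos.2 hTpos
  have hss : √(T : ℝ) * √T = T := Real.mul_self_sqrt hTpos.le
  have hs8 : 8 ≤ √(T : ℝ) := Real.le_sqrt_of_sq_le (by norm_num; exact_mod_cast hT64)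
  have hm : 0 < min q (1 - q) := lt_min hq.1 (by linarith [hq.2])
  set l := γ / √T with hl
  have hl0 : 0 < l := by positivity
  have hls : l * √T = γ := by rw [hl]; field_simp
  have hlm : l ≤ min q (1 - q) := by
    rw [hl, div_le_comm₀ hs0 hm]
    exact Real.le_sqrt_of_sq_le hTγ
  have hr : q + e * l ∈ Set.Icc (0 : ℝ) 1 := by
    have a1 := hlm.trans (min_le_left _ _)
    have a2 := hlm.trans (min_le_right _ _)
    rcases he with rfl | rfl <;> constructor <;> linarith
  have hk := isTransition_iidKernel hr
  -- The initial counts `0, …, L` spread over order `√T` points, so the flatness bound `θ √t`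
  -- becomes at most `θ` after averaging over them.
  set L := ⌈√(T : ℝ)⌉₊ with hL
  have hL1 : √(T : ℝ) ≤ L := Nat.le_ceil _
  have hL2 : (L : ℝ) ≤ √T + 1 := (Nat.ceil_lt_add_one hs0.le).le
  have hLT : L ≤ T := by
    have : (L : ℝ) ≤ T := by nlinarith
    exact_mod_cast this
  obtain ⟨m, hm'⟩ := Nat.exists_eq_add_of_le hLT
  have hmT : (m : ℝ) = T - L := by
    have : (T : ℝ) = L + m := by exact_mod_cast hm'
    linarith
  let D : ℕ → ℕ → ℝ := fun i u => pathExp (iidKernel (q + e * l)) L i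
    (fun y => |(response f (L + i + 1) y : ℝ) - p|) (initialOnes u)
  have hexp : ∀ u, l * (m * (1 - p) - ∑ i ∈ Finset.range m, D i u) ≤ C * √T + L := fun u =>
    drift_regret_bound hq' he hl0.le hr (fun y => by
      rw [← hm']
      exact h₁ T hTT₀ y) (initialOnes u)
  have hD1 : ∀ i u, D i u ≤ 1 := fun i u => by
    have := pathExp_mono hk L i (F := fun y => |(response f (L + i + 1) y : ℝ) - p|)
      (F' := fun _ => 1) (fun y =>
        abs_coe_sub_le_one _ (Set.Ioo_subset_Icc_self hp)) (initialOnes u)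
    rwa [pathExp_const hk] at this
  have hDlate : ∀ i, i ≤ m → θ * T ≤ (L + i : ℕ) →
      ∑ u ∈ Finset.range (L + 1), D i u ≤ 2 * θ * (L + 1) := by
    intro i him hit
    have htpos : (0 : ℝ) < (L + i : ℕ) := lt_of_lt_of_le (by positivity) hit
    have htT : ((L + i : ℕ) : ℝ) ≤ T := by exact_mod_cast (show L + i ≤ T by omega)
    have htT1 : T₁ ≤ L + i := by
      have : (T₁ : ℝ) ≤ (L + i : ℕ) := by linarith
      exact_mod_cast this
    have hd : (e * l) ^ 2 * T = γ ^ 2 := by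
      rw [mul_pow, sq e, hee, one_mul, ← hss, ← hls]; ring
    have hL4 : (L : ℝ) ^ 2 ≤ 4 * T := by
      have := pow_le_pow_left₀ (Nat.cast_nonneg _) (show (L : ℝ) ≤ 2 * √T by linarith) 2
      rw [mul_pow, Real.sq_sqrt hTpos.le] at this
      linarith
    refine (sum_pathExp_response_sub_le (Set.Ioo_subset_Icc_self hp) hq' hr hd hL4
      (show i ≤ T by omega) hΓ0 (by exact_mod_cast htpos) (hT₁ _ htT1)).trans ?_
    have b1 : θ * √((L + i : ℕ) : ℝ) ≤ θ * (L + 1) :=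
      mul_le_mul_of_nonneg_left (by linarith [Real.sqrt_le_sqrt htT]) hθ0.le
    have b2 : Real.exp (γ ^ 2) * (6 * T) / (Γ ^ 2 * (L + i : ℕ)) ≤ θ := by
      rw [div_le_iff₀ (by positivity)]
      have := mul_le_mul_of_nonneg_left hit (show 0 ≤ Γ ^ 2 * θ by positivity)
      rw [show Γ ^ 2 * θ * (θ * T) = Γ ^ 2 * (θ * θ) * T by ring, hΓ2] at this
      linarith
    have b3 := mul_le_mul_of_nonneg_left b2 (show (0 : ℝ) ≤ L + 1 by positivity)
    linarith
  -- For `i < K` the deviation is bounded by `1`; the window estimate needs `L + i ≥ θ T`.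
  set K := ⌈θ * T⌉₊ with hK
  have hKle : (K : ℝ) ≤ 2 * θ * T := by
    have a1 := (Nat.ceil_lt_add_one (show 0 ≤ θ * T by positivity)).le
    have a2 : (0 : ℝ) ≤ T₁ := Nat.cast_nonneg _
    linarith
  have hDsum : ∑ i ∈ Finset.range m, ∑ u ∈ Finset.range (L + 1), D i u ≤
      (4 * θ * T) * (L + 1) := by
    have a1 : ∀ i ∈ Finset.range m, ∑ u ∈ Finset.range (L + 1), D i u ≤
        (if i ∈ Finset.range K then ((L : ℝ) + 1) else 0) + 2 * θ * (L + 1) := by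
      intro i hi
      have hi := Finset.mem_range.1 hi
      by_cases h : i ∈ Finset.range K
      · rw [if_pos h]
        have : ∑ u ∈ Finset.range (L + 1), D i u ≤ ∑ u ∈ Finset.range (L + 1), (1 : ℝ) :=
          Finset.sum_le_sum fun u _ => hD1 i u
        simp only [Finset.sum_const, Finset.card_range, nsmul_eq_mul, mul_one] at this
        push_cast at this
        have : (0 : ℝ) ≤ 2 * θ * (L + 1) := by positivity
        linarith
      · rw [if_neg h, zero_add]
        refine hDlate i hi.le ?_
        have h1 : K ≤ L + i := by have := Finset.mem_range.not.1 h; omega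
        exact (Nat.le_ceil _).trans (by exact_mod_cast h1)
    refine (Finset.sum_le_sum a1).trans ?_
    rw [Finset.sum_add_distrib, ← Finset.sum_filter, Finset.sum_const, Finset.sum_const,
      Finset.card_range, nsmul_eq_mul, nsmul_eq_mul]
    have a2 : ((Finset.range m).filter (· ∈ Finset.range K)).card ≤ K := by
      refine (Finset.card_le_card (t := Finset.range K) fun z hz => (Finset.mem_filter.1 hz).2).trans ?_
      simp
    have a3 : (((Finset.range m).filter (· ∈ Finset.range K)).card : ℝ) ≤ 2 * θ * T :=
      le_trans (by exact_mod_cast a2) hKle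
    have a4 : (m : ℝ) ≤ T := by rw [hmT]; linarith
    have a5 := mul_le_mul_of_nonneg_right a3 (show (0 : ℝ) ≤ L + 1 by positivity)
    have a6 := mul_le_mul_of_nonneg_right a4 (show (0 : ℝ) ≤ 2 * θ * (L + 1) by positivity)
    linarith
  -- The regret bounds are added over the initial counts: only the sum over `u` of the deviations is
  -- controlled. At `4 θ T` on average, these use up a quarter of `(1 - p) T`.
  have hall := Finset.sum_le_sum fun u (_ : u ∈ Finset.range (L + 1)) => hexp u
  rw [← Finset.mul_sum, Finset.sum_sub_distrib, Finset.sum_comm, Finset.sum_const, Finset.sum_const,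
    Finset.card_range, nsmul_eq_mul, nsmul_eq_mul] at hall
  push_cast at hall
  have hL0 : (0 : ℝ) < L + 1 := by positivity
  have hfin : l * (m * (1 - p) - 4 * θ * T) ≤ C * √T + L := by
    refine le_of_mul_le_mul_left ?_ hL0
    refine le_trans (le_of_eq ?_) (le_trans (mul_le_mul_of_nonneg_left
      (sub_le_sub_left hDsum _) hl0.le) hall)
    ring
  have hm2 : 3 / 4 * (T : ℝ) ≤ m := by rw [hmT]; nlinarith
  have hfin2 : l * (1 / 2 * (1 - p) * T) ≤ C * √T + L := by
    refine le_trans (mul_le_mul_of_nonneg_left ?_ hl0.le) hfin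
    have := mul_le_mul_of_nonneg_right hm2 hp1.le
    rw [hθ]; linarith
  have hfin3 : l * (1 / 2 * (1 - p) * T) = C' * √T := by
    have e1 : l * (1 / 2 * (1 - p) * T) = (l * √T) * (1 - p) / 2 * √T := by
      linear_combination (-(l * (1 - p) / 2)) * hss
    rw [e1, hls, hγp]
    ring
  rw [hfin3, hC'] at hfin2
  have := mul_le_mul_of_nonneg_right (le_max_left C 0) hs0.le
  nlinarith

/-! ### Convergence in mean and the distribution of counts -/

section
variable {Ω : Type*} [MeasurableSpace Ω] {μ : Measure Ω} [IsProbabilityMeasure μ]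
  {f g : MeanBasedStrategy} {I J : ℕ → Ω → Fin 2}

lemma measurable_mixedStrategy (f : MeanBasedStrategy) {X : ℕ → Ω → Fin 2}
    (hX : ∀ t, Measurable (X t)) (t : ℕ) : Measurable (mixedStrategy f X (t + 1)) := by
  have h1 : mixedStrategy f X (t + 1) = fun ω => f (t + 1) (freq t (countOne (fun s => X s ω) t)) :=
    funext fun ω => response_succ f _ t
  have h2 : Measurable fun ω => countOne (fun s => X s ω) t :=
    Finset.measurable_sum _ fun s _ => Measurable.of_discrete.comp (hX (s + 1))
  rw [h1]
  exact (Measurable.of_discrete (f := fun z : ℕ => f (t + 1) (freq t z))).comp h2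

/-- Convergence in probability of bounded variables implies convergence of the means. -/
lemma tendsto_integral_of_tendsto_prob {Y : ℕ → Ω → ℝ} (hY : ∀ t, Measurable (Y t))
    (h0 : ∀ t ω, 0 ≤ Y t ω) (h1 : ∀ t ω, Y t ω ≤ 1)
    (h : ∀ δ : ℝ, 0 < δ → ∀ ε : ℝ, 0 < ε → ∀ᶠ t in atTop, μ {ω | δ ≤ Y t ω} < ENNReal.ofReal ε) :
    Tendsto (fun t => ∫ ω, Y t ω ∂μ) atTop (nhds 0) := by
  rw [Metric.tendsto_atTop]
  intro ε hε
  obtain ⟨N, hN⟩ := eventually_atTop.1 (h (ε / 3) (by positivity) (ε / 3) (by positivity))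
  refine ⟨N, fun t ht => ?_⟩
  rw [Real.dist_eq, sub_zero, abs_of_nonneg (integral_nonneg (h0 t))]
  have hms : MeasurableSet {ω | ε / 3 ≤ Y t ω} := measurableSet_le measurable_const (hY t)
  have hreal : μ.real {ω | ε / 3 ≤ Y t ω} ≤ ε / 3 :=
    ENNReal.toReal_le_of_le_ofReal (by positivity) (hN t ht).le
  have hle : ∫ ω, Y t ω ∂μ ≤ ∫ ω, (ε / 3 + Set.indicator {ω | ε / 3 ≤ Y t ω} (fun _ => (1 : ℝ)) ω) ∂μ := by
    refine integral_mono_of_nonneg (Eventually.of_forall (h0 t))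
      ((integrable_const _).add ((integrable_const _).indicator hms))
      (Eventually.of_forall fun ω => ?_)
    by_cases hω : ε / 3 ≤ Y t ω
    · simp only [Set.indicator, Set.mem_ofPred_eq, hω, if_true]
      linarith [h1 t ω]
    · simp only [Set.indicator, Set.mem_ofPred_eq, hω, if_false]
      linarith
  rw [integral_add (integrable_const _) ((integrable_const _).indicator hms),
    integral_indicator_const _ hms] at hle
  simp only [integral_const, probReal_univ, smul_eq_mul, mul_one, one_mul] at hle
  linarith

lemma IsPlay.expect_mixedStrategy (h : IsPlay μ f g I J) (t : ℕ) (x : ℕ → Fin 2 × Fin 2) :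
    (expect μ (mixedStrategy g I (t + 1)) : ℝ) =
      pathExp (playKernel f g) 0 t (fun y => (response g (t + 1) fun s => (y s).1 : ℝ)) x :=
  h.integral_eq (F := fun y => (response g (t + 1) fun s => (y s).1 : ℝ)) (fun y y' hy => by
    simp only [response_fst_congr g hy]) x

lemma IsPlay.integral_abs_mixedStrategy_sub (h : IsPlay μ f g I J) (p : ℝ) (t : ℕ)
    (x : ℕ → Fin 2 × Fin 2) :
    ∫ ω, |(mixedStrategy f J (t + 1) ω : ℝ) - p| ∂μ =
      pathExp (playKernel f g) 0 t
        (fun y => |(response f (t + 1) fun s => (y s).2 : ℝ) - p|) x :=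
  h.integral_eq (F := fun y => |(response f (t + 1) fun s => (y s).2 : ℝ) - p|) (fun y y' hy => by
    simp only [response_snd_congr f hy]) x

/-- The mean deviation of player 1's mixed strategy, by the values of player 2's counts. -/
lemma sum_mul_count_le_integral (f : MeanBasedStrategy) (hJ : ∀ t, Measurable (J t)) {p : ℝ}
    (hp : p ∈ Set.Icc (0 : ℝ) 1) {t : ℕ} (ht : 0 < t) (S : Finset ℕ) :
    ∑ z ∈ S, |(f (t + 1) (freq t z) : ℝ) - p| *
      μ.real {ω | (t : ℝ) * (empAvg (fun s => J s ω) t : ℝ) = z} ≤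
      ∫ ω, |(mixedStrategy f J (t + 1) ω : ℝ) - p| ∂μ := by
  have hset : ∀ z : ℕ, {ω | (t : ℝ) * (empAvg (fun s => J s ω) t : ℝ) = z} =
      {ω | countOne (fun s => J s ω) t = z} := by
    intro z
    ext ω
    have : (t : ℝ) ≠ 0 := by exact_mod_cast ht.ne'
    simp only [Set.mem_ofPred_eq, empAvg_coe, mul_div_cancel₀ _ this, Nat.cast_inj]
  have hmeas : Measurable fun ω => countOne (fun s => J s ω) t :=
    Finset.measurable_sum _ fun s _ => Measurable.of_discrete.comp (hJ (s + 1))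
  have hms : ∀ z : ℕ, MeasurableSet {ω | countOne (fun s => J s ω) t = z} := fun z =>
    hmeas (measurableSet_singleton z)
  simp only [hset]
  have h1 : ∀ z, |(f (t + 1) (freq t z) : ℝ) - p| * μ.real {ω | countOne (fun s => J s ω) t = z} =
      ∫ ω, Set.indicator {ω | countOne (fun s => J s ω) t = z}
        (fun _ => |(f (t + 1) (freq t z) : ℝ) - p|) ω ∂μ := fun z => by
    rw [integral_indicator_const _ (hms z), smul_eq_mul, mul_comm]
  simp only [h1]
  rw [← integral_finsetSum _ fun z _ => (integrable_const _).indicator (hms z)]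
  have hint : Integrable (fun ω => |(mixedStrategy f J (t + 1) ω : ℝ) - p|) μ :=
    Integrable.of_bound (C := 1)
      (((measurable_subtype_coe.comp (measurable_mixedStrategy f hJ t)).sub_const
        p).norm.aestronglyMeasurable)
      (Eventually.of_forall fun ω => by
        rw [Real.norm_eq_abs, abs_abs]
        exact abs_coe_sub_le_one _ hp)
  refine integral_mono (integrable_finsetSum _ fun z _ => (integrable_const _).indicator (hms z))
    hint fun ω => ?_
  simp only [Set.indicator_apply, Set.mem_ofPred_eq, Finset.sum_ite_eq]
  split_ifs
  · rw [mixedStrategy, response_succ]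
  · exact abs_nonneg _

end
end

end RepeatedGame

/-! ### Conclusion -/

open RepeatedGame
theorem mainTheorem6 {Ω : Type*} [MeasurableSpace Ω] (μ : Measure Ω) [IsProbabilityMeasure μ]
    (G H : Payoff) (hGH : IsCompetitive G H)
    (pStar qStar : unitInterval) (hNash : IsNashEquilibrium G H pStar qStar)
    (f g : MeanBasedStrategy) (I J : ℕ → Ω → Fin 2) (hplay : IsPlay μ f g I J)
    (c₁ c₂ : ℝ)
    (hregret₁ : HasRegretRate G (response f) (1 / 2) c₁)
    (hregret₂ : HasRegretRate (fun j i => H i j) (response g) (1 / 2) c₂)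
    (hshaky : ShakyHands μ g I J qStar) :
    ∃ δ : ℝ, 0 < δ ∧ ∃ ε₀ : ℝ, 0 < ε₀ ∧
      ENNReal.ofReal ε₀ ≤
        limsup (fun t : ℕ => μ {ω | δ ≤ |(mixedStrategy f J t ω : ℝ) - (pStar : ℝ)|}) atTop := by
  by_contra! hcon
  obtain ⟨⟨hp0, hp1, hq0, hq1⟩, hsG, hsH⟩ := hNash.interior hGH
  have hp : (pStar : ℝ) ∈ Set.Ioo (0 : ℝ) 1 := ⟨hp0, hp1⟩
  have hq : (qStar : ℝ) ∈ Set.Ioo (0 : ℝ) 1 := ⟨hq0, hq1⟩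
  have hpI := Set.Ioo_subset_Icc_self hp
  have hqI := Set.Ioo_subset_Icc_self hq
  -- the regret bounds, up to the scale of the payoffs
  obtain ⟨e, he, d, hd, d', hd', hdG, hdH⟩ : ∃ e : ℝ, (e = 1 ∨ e = -1) ∧ ∃ d : ℝ, 0 < d ∧
      ∃ d' : ℝ, 0 < d' ∧ (∀ j : Fin 2, G 1 j - G 0 j = d * e * (((j : ℕ) : ℝ) - qStar)) ∧
      ∀ i : Fin 2, H i 1 - H i 0 = d' * -e * (((i : ℕ) : ℝ) - pStar) := by
    rcases hGH with hc | hc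
    · refine ⟨1, Or.inl rfl, (G 1 1 - G 0 1) - (G 1 0 - G 0 0), by linarith,
        (H 0 1 - H 0 0) - (H 1 1 - H 1 0), by linarith, fun j => ?_, fun i => ?_⟩
      · fin_cases j <;> simp <;> linarith
      · fin_cases i <;> simp <;> linarith
    · refine ⟨-1, Or.inr rfl, (G 1 0 - G 0 0) - (G 1 1 - G 0 1), by linarith,
        (H 1 1 - H 1 0) - (H 0 1 - H 0 0), by linarith, fun j => ?_, fun i => ?_⟩
      · fin_cases j <;> simp <;> linarith
      · fin_cases i <;> simp <;> linarith
  obtain ⟨C₁, T₁, h₁⟩ := hregret₁.exists_bound hd hdG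
  obtain ⟨C₂, T₂, h₂⟩ := hregret₂.exists_bound hd' hdH
  set C := max C₁ C₂
  set T₀ := max T₁ T₂
  have h₁' : ∀ T, T₀ ≤ T → ∀ x : ℕ → Fin 2, max 0 (e * excess qStar x T) -
      e * ∑ t ∈ Finset.range T, (response f (t + 1) x : ℝ) *
        (((x (t + 1) : ℕ) : ℝ) - qStar) ≤ C * √T := fun T hT x =>
    (h₁ T ((le_max_left _ _).trans hT) x).trans
      (mul_le_mul_of_nonneg_right (le_max_left _ _) (Real.sqrt_nonneg _))
  have h₂' : ∀ T, T₀ ≤ T → ∀ x : ℕ → Fin 2, max 0 (-e * excess pStar x T) -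
      -e * ∑ t ∈ Finset.range T, (response g (t + 1) x : ℝ) *
        (((x (t + 1) : ℕ) : ℝ) - pStar) ≤ C * √T := fun T hT x =>
    (h₂ T ((le_max_right _ _).trans hT) x).trans
      (mul_le_mul_of_nonneg_right (le_max_right _ _) (Real.sqrt_nonneg _))
  -- convergence in mean of player 1's mixed strategies
  have hconv : Tendsto (fun t => ∫ ω, |(mixedStrategy f J (t + 1) ω : ℝ) - pStar| ∂μ) atTop
      (nhds 0) := by
    refine tendsto_integral_of_tendsto_prob (fun t => ?_) (fun t ω => abs_nonneg _)
      (fun t ω => abs_coe_sub_le_one _ hpI) fun δ hδ ε hε => ?_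
    · exact ((measurable_subtype_coe.comp
        (measurable_mixedStrategy f hplay.measurable_snd t)).sub_const _).norm
    · exact (tendsto_add_atTop_nat 1).eventually (eventually_lt_of_limsup_lt (hcon δ hδ ε hε))
  have hconv' := hconv
  -- The base path is arbitrary, as all rounds from the first on are averaged out.
  simp only [hplay.integral_abs_mixedStrategy_sub _ _ (fun _ => 0)] at hconv'
  obtain ⟨κ, hκ, T₃, hV⟩ := exists_variance_lower_bound hp hq he h₁' h₂' (fun _ => 0) hconv'
  simp only [← hplay.expect_mixedStrategy] at hV
  set m := min (pStar : ℝ) (1 - pStar)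
  have hm : 0 < m := lt_min hp0 (by linarith)
  set C' := 2 * max C 0 / m with hC'
  have hC'0 : 0 ≤ C' := by positivity
  have hmean : ∀ T, T₀ ≤ T → |∑ t ∈ Finset.range T,
      ((expect μ (mixedStrategy g I (t + 1)) : ℝ) - qStar)| ≤ C' * √T := fun T hT => by
    simp only [hplay.expect_mixedStrategy _ (fun _ => 0)]
    refine (abs_sum_mean_sub_le hp hqI he (h₁' T hT) (h₂' T hT) (fun _ => 0)).trans ?_
    rw [hC', div_mul_eq_mul_div]
    refine div_le_div_of_nonneg_right ?_ hm.le
    have := mul_le_mul_of_nonneg_right (le_max_left C 0) (Real.sqrt_nonneg (T : ℝ))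
    linarith
  refine not_flat_of_regret_bound hp hq he h₁' fun Γ hΓ ε hε => ?_
  -- The radius is enlarged by `C'` because the Bernoulli sum is centred at `∑ r s`, within `C' √t`
  -- of `t qStar`.
  obtain ⟨c, hc, T₄, hT₄, hlocal⟩ :=
    exists_local_lower_bound hκ (Γ := Γ + C') (by positivity)
  obtain ⟨ε', hε', T₅, hT₅, hsh⟩ := hshaky Γ hΓ
  -- Each count in the window has probability at least `ε' c / √t`; dividing the mean deviation by
  -- this leaves `ε √t`.
  obtain ⟨T₆, hT₆⟩ := eventually_atTop.1
    (hconv.eventually_le_const (show (0 : ℝ) < ε * (ε' * c) by positivity))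
  refine ⟨max (max T₀ T₃) (max (max T₄ T₅) T₆), fun t ht => ?_⟩
  simp only [max_le_iff] at ht
  obtain ⟨⟨ht0, ht3⟩, ⟨ht4, ht5⟩, ht6⟩ := ht
  have htpos : 0 < t := by omega
  have hs0 : 0 < √(t : ℝ) := Real.sqrt_pos.2 (by exact_mod_cast htpos)
  set r : ℕ → unitInterval := fun s => expect μ (mixedStrategy g I s) with hr
  have hV' : κ * t ≤ ∑ s ∈ Finset.Icc 1 t, (r s : ℝ) * (1 - r s) := by
    rw [sum_Icc_one_eq_sum_range]; exact hV t ht3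
  have hmean' : |∑ s ∈ Finset.Icc 1 t, (r s : ℝ) - t * qStar| ≤ C' * √t := by
    have := hmean t ht0
    rw [Finset.sum_sub_distrib] at this
    rw [sum_Icc_one_eq_sum_range (fun s => (r s : ℝ))]
    simpa using this
  have hpoint : ∀ z : ℕ, |(z : ℝ) - t * qStar| ≤ Γ * √t → ε' * (c / √t) ≤
      μ.real {ω | (t : ℝ) * (empAvg (fun s => J s ω) t : ℝ) = z} := by
    intro z hz
    have hz' := abs_le.1 hz
    refine le_trans (mul_le_mul_of_nonneg_left ?_ hε'.le)
      (hsh t ht5 z ⟨by linarith, by linarith⟩)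
    rw [bernoulliSumLaw_real_singleton]
    refine hlocal (fun s => r s) (fun s => (r s).2) t ht4 hV' z ?_
    have hmm := abs_le.1 hmean'
    push_cast
    exact abs_le.2 ⟨by linarith, by linarith⟩
  have hsum := sum_mul_count_le_integral (μ := μ) f hplay.measurable_snd hpI htpos
    ((Finset.range (t + 1)).filter fun z : ℕ => |(z : ℝ) - t * qStar| ≤ Γ * √t)
  have hsum2 := (Finset.sum_le_sum fun z hz => mul_le_mul_of_nonneg_left
    (hpoint z (Finset.mem_filter.1 hz).2)
    (abs_nonneg ((f (t + 1) (freq t z) : ℝ) - pStar))).trans (hsum.trans (hT₆ t ht6))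
  rw [← Finset.sum_mul] at hsum2
  have hpos : 0 < ε' * (c / √t) := by positivity
  refine le_of_mul_le_mul_right (hsum2.trans (le_of_eq ?_)) hpos
  field_simp
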